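/- Let $\sigma$ be the uniform probability distribution on the unit sphere $\mathbb{S}^{d-1}\subset\mathbb{R}^d$ and let $\|\cdot\|_2,\|\cdot\|_\infty$ be the norms of $L^2(\sigma),L^\infty(\sigma)$. Let $\mathbb{Y}_{k,d}$ be the space of spherical harmonics of degree $k$ (restrictions to $\mathbb{S}^{d-1}$ of harmonic homogeneous polynomials of degree $k$), $\mathbb{Y}_{\le k,d}=\sum_{l\le k}\mathbb{Y}_{l,d}$, $\Pi_k$ the orthogonal projection of $L^2(\sigma)$ onto $\mathbb{Y}_{k,d}$, and $N_{k,d}=\binom{d+k-1}{d-1}-\binom{d+k-3}{d-1}$. There is a polynomial $P$ in four variables with non-negative integer coefficients (an absolute polynomial, independent of all parameters below) such that the following holds. Let $\alpha\in(0,1]$, $c_1,c_2>0$, let $d$ be an integer with $d\ge 10\alpha^{-1}2^{5/\alpha}+2$, and let $f\in L^2(\sigma)$ be a function on $\mathbb{S}^{d-1}$ such that for all $k\ge 0$ $$\|\Pi_k f\|_2\le c_1N_{k,d}^{-\alpha/2}\quad\text{and}\quad \|\Pi_k f\|_\infty\le c_2\sqrt{\ln(k+1)}\,\|\Pi_k f\|_2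 .$$ Let $\epsilon,\delta>0$ and let $n$ be any integer with $n\ge P(c_1c_2,\,d,\,1/\epsilon,\,\ln(1/\delta))^{1/\alpha}$. Consider the following algorithm with parameters $\alpha,c_1,c_2,\epsilon$ and input $(x_1,y_1),\dots,(x_n,y_n)\in\mathbb{S}^{d-1}\times\mathbb{R}$: let $k$ be the least integer $l\ge0$ with $2c_1c_2(l+1)^{3/2}N_{l+1,d}^{-\alpha/2}\le\epsilon/2$, let $\mathcal{F}_k=\{g\in\mathbb{Y}_{\le k,d}:\|\Pi_l g\|_2\le c_1\ \text{for all } 0\le l\le k\}$, and return a minimizer $g$ of $h\mapsto\sum_{i=1}^n(h(x_i)-y_i)^2$ over $h\in\mathcal{F}_k$. Then the algorithm has an output for every input. If moreover $x_1,\dots,x_n$ are independent and uniform on $\mathbb{S}^{d-1}$ and $y_i=f(x_i)+\xi_i$ with $\xi_i\sim\mathcal{N}(0,1)$ independent of each other and of the $x_i$, then with probability at least $1-\delta$ every output $g$ of the algorithm satisfies $\|f-g\|_\infty\le\epsilon$; if $f$ is continuous, then on the same event also $|f(x)-g(x)|\le\epsilon$ for every $x\in\mathbb{S}^{d-1}$.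 -/

import Mathlib

open MeasureTheory ProbabilityTheory
open scoped ENNReal

noncomputable section

/-- The unit sphere `S^{d-1}` in `ℝ^d`. -/
abbrev Sph (d : ℕ) : Type := Metric.sphere (0 : EuclideanSpace ℝ (Fin d)) 1

/-- The uniform probability distribution on `S^{d-1}` (for `d ≥ 1`): the normalized surface
measure. -/
def unif (d : ℕ) : Measure (Sph d) :=
  ((volume : Measure (EuclideanSpace ℝ (Fin d))).toSphere Set.univ)⁻¹ •
    (volume : Measure (EuclideanSpace ℝ (Fin d))).toSphere

instance unif_isFiniteMeasure (d : ℕ) : IsFiniteMeasure (unif d) where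
  measure_univ_lt_top := by
    rw [unif, Measure.smul_apply, smul_eq_mul]
    exact lt_of_le_of_lt (ENNReal.inv_mul_le_one _) ENNReal.one_lt_top

/-- The `i`-th coordinate function on the sphere. -/
def coordFn (d : ℕ) (i : Fin d) : C(Sph d, ℝ) where
  toFun x := (x : EuclideanSpace ℝ (Fin d)) i
  continuous_toFun := by fun_prop

/-- The Laplacian `∑ i, ∂ᵢ²` on real polynomials in `d` variables. -/
def polyLaplacian (d : ℕ) : MvPolynomial (Fin d) ℝ →ₗ[ℝ] MvPolynomial (Fin d) ℝ :=
  ∑ i : Fin d, (MvPolynomial.pderiv i : Derivation ℝ _ _).toLinearMap ∘ₗ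
    (MvPolynomial.pderiv i : Derivation ℝ _ _).toLinearMap

/-- The space `𝕐_{k,d}` of degree-`k` spherical harmonics: restrictions to the sphere of the
harmonic homogeneous polynomials of degree `k` in `d` variables. -/
def harmonics (d k : ℕ) : Submodule ℝ C(Sph d, ℝ) :=
  (MvPolynomial.homogeneousSubmodule (Fin d) ℝ k ⊓ LinearMap.ker (polyLaplacian d)).map
    (MvPolynomial.aeval (coordFn d)).toLinearMap

/-- The space `𝕐_{≤k,d}` of spherical harmonics of degree up to `k`. -/
def harmonicsLE (d k : ℕ) : Submodule ℝ C(Sph d, ℝ) :=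
  ⨆ (l : ℕ) (_ : l ≤ k), harmonics d l

/-- The number `N_{k,d} = C(d+k-1, d-1) - C(d+k-3, d-1)`. -/
def harmDim (d k : ℕ) : ℕ := (d + k - 1).choose (d - 1) - (d + k - 3).choose (d - 1)

/-- The Hilbert space `L²(S^{d-1})` with respect to the uniform distribution. -/
abbrev L2Sph (d : ℕ) : Type := Lp ℝ 2 (unif d)

/-- The class in `L²(S^{d-1})` of a continuous function. -/
def toL2 (d : ℕ) : C(Sph d, ℝ) →L[ℝ] L2Sph d := ContinuousMap.toLp 2 (unif d) ℝ

/-- `𝕐_{k,d}` as a subspace of `L²(S^{d-1})`. -/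
def harmonicsL2 (d k : ℕ) : Submodule ℝ (L2Sph d) := (harmonics d k).map (toL2 d).toLinearMap

instance harmonicsL2_finiteDimensional (d k : ℕ) : FiniteDimensional ℝ (harmonicsL2 d k) := by
  have h : (MvPolynomial.homogeneousSubmodule (Fin d) ℝ k).FG :=
    MvPolynomial.homogeneousSubmodule_fg (Fin d) ℝ k
  have h1 : FiniteDimensional ℝ (MvPolynomial.homogeneousSubmodule (Fin d) ℝ k) :=
    Module.Finite.iff_fg.mpr h
  have h2 : FiniteDimensional ℝ
      ↥(MvPolynomial.homogeneousSubmodule (Fin d) ℝ k ⊓ LinearMap.ker (polyLaplacian d)) :=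
    Submodule.finiteDimensional_of_le inf_le_left
  unfold harmonicsL2 harmonics
  infer_instance

/-- `Π_k`, the orthogonal projection of `L²(S^{d-1})` onto `𝕐_{k,d}`. -/
def harmProj (d k : ℕ) : L2Sph d →L[ℝ] L2Sph d := (harmonicsL2 d k).starProjection

/-- Decay of the spherical harmonics components:
`‖Π_k f‖_2 ≤ c₁ N_{k,d}^{-α/2}` for all `k ≥ 0`. -/
def DecayCond (d : ℕ) (α c₁ : ℝ) (f : L2Sph d) : Prop :=
  ∀ k : ℕ, ‖harmProj d k f‖ ≤ c₁ * (harmDim d k : ℝ) ^ (-α / 2)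

/-- The components are not spiky:
`‖Π_k f‖_∞ ≤ c₂ √(ln (k+1)) ‖Π_k f‖_2` for all `k ≥ 0`. -/
def NotSpikyCond (d : ℕ) (c₂ : ℝ) (f : L2Sph d) : Prop :=
  ∀ k : ℕ, eLpNorm (harmProj d k f) ∞ (unif d) ≤
    ENNReal.ofReal (c₂ * √(Real.log ((k : ℝ) + 1)) * ‖harmProj d k f‖)

/-- `k` is the truncation threshold of the algorithm: the least `l ≥ 0` such that
`2 c₁ c₂ (l+1)^{3/2} N_{l+1,d}^{-α/2} ≤ ε / 2`. -/
def IsTruncThreshold (d : ℕ) (α c₁ c₂ ε : ℝ) (k : ℕ) : Prop :=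
  IsLeast {l : ℕ | 2 * c₁ * c₂ * ((l : ℝ) + 1) ^ (3 / 2 : ℝ) *
    (harmDim d (l + 1) : ℝ) ^ (-α / 2) ≤ ε / 2} k

/-- The function class `𝓕_k = {g ∈ 𝕐_{≤k,d} : ‖Π_l g‖_2 ≤ c₁ for all l ∈ [0,k]}`. -/
def funClass (d : ℕ) (c₁ : ℝ) (k : ℕ) : Set C(Sph d, ℝ) :=
  {g | g ∈ harmonicsLE d k ∧ ∀ l ≤ k, ‖harmProj d l (toL2 d g)‖ ≤ c₁}

/-- `g` is an output of the algorithm with parameters `α, c₁, c₂, ε` on the dataset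
`D = ((x₁,y₁),…,(xₙ,yₙ))`: with `k` the truncation threshold, `g` minimizes the empirical squared
loss over the class `𝓕_k`. -/
def IsOutput (d : ℕ) (α c₁ c₂ ε : ℝ) {n : ℕ} (D : Fin n → Sph d × ℝ) (g : C(Sph d, ℝ)) : Prop :=
  ∃ k : ℕ, IsTruncThreshold d α c₁ c₂ ε k ∧
    g ∈ funClass d c₁ k ∧
    ∀ h ∈ funClass d c₁ k, ∑ i, (g (D i).1 - (D i).2) ^ 2 ≤ ∑ i, (h (D i).1 - (D i).2) ^ 2

/-- The joint law of `n` independent pairs `(xᵢ, ξᵢ)`, where `xᵢ` is uniform on the sphere and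
`ξᵢ ~ N(0,1)` is independent of `xᵢ`. -/
def sampleLaw (d n : ℕ) : Measure (Fin n → Sph d × ℝ) :=
  Measure.pi fun _ => (unif d).prod (gaussianReal 0 1)

/-- The dataset `(xᵢ, yᵢ)`, `yᵢ = f(xᵢ) + ξᵢ`, built from the points and the noise. -/
def dataset {d n : ℕ} (f : Sph d → ℝ) (ω : Fin n → Sph d × ℝ) : Fin n → Sph d × ℝ :=
  fun i => ((ω i).1, f (ω i).1 + (ω i).2)

end

/-! ### Moments of the Gaussian weight and integration by parts -/

section GaussianMoments

/-! Approximation. The decay and non-spikiness conditions bound `‖Π_l f‖_∞` by `c₁c₂ √(ln(l+1))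
N_l^{-α/2}`. In dimension `d ≥ 10α⁻¹2^{5/α}+2` the numbers `N_l` grow so fast that `l^{5/2}
N_l^{-α/2}` is nonincreasing for `l ≥ 1`, so these bounds are summable with telescoping tails
(`summable_and_tsum_tail_le`). Hence `f` agrees a.e. with a continuous `F`, and its truncation `G ∈
𝕐_{≤k}` satisfies `|F - G| ≤ ε/2` with `F - G` orthogonal to `𝕐_{≤k}`
(`exists_continuous_truncation`). Conversely, minimality of `k` forces `dim 𝕐_{≤k} ≤ N_k^3 ≤
B^{15/α}` with `B = 1 + 4c₁c₂/ε`, when `k ≥ 1` (`finrank_bound_of_isTruncThreshold`).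

Estimation. An orthonormal basis `φ_j` of `𝕐_{≤k}`, of dimension `D`, satisfies `∑ φ_j(x)² = D` at
every point by rotation invariance. Sub-Gaussian tails and a union bound make the empirical Gram
matrix close to the identity and the residual `F - G` and the noise nearly uncorrelated with each
`φ_j` on the sample (`exists_good_event`). Comparing the minimizer `g` with `G` then bounds the
coefficients of `g - G`, and the diagonal identity turns this into `|g - G| ≤ ε/2` everywhere
(`abs_sum_le_of_empirical`).

The required facts on harmonics (orthogonality, decomposition of polynomials, completeness) come
from Gaussian integrals of polynomials, dimension counting and Stone–Weierstrass. -/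

lemma integrable_pow_mul_gaussian (n : ℕ) :
    Integrable (fun x : ℝ => x ^ n * Real.exp (-x ^ 2 / 2)) := by
  have h := integrable_rpow_mul_exp_neg_mul_sq (b := 1 / 2) (by norm_num) (s := n)
    (by have := Nat.cast_nonneg (α := ℝ) n; linarith)
  refine h.congr (Filter.Eventually.of_forall fun x => ?_)
  simp only [Real.rpow_natCast]
  ring_nf

/-- The (unnormalized) moments of the one-dimensional Gaussian. -/
noncomputable def gaussMoment (n : ℕ) : ℝ := ∫ x : ℝ, x ^ n * Real.exp (-x ^ 2 / 2)

/-- The derivative of `x^n e^{-x²/2}` integrates to zero. For `n = 0` the truncated `n - 1` is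
harmless because of the factor `n`. -/
lemma gaussMoment_succ (n : ℕ) : gaussMoment (n + 1) = n * gaussMoment (n - 1) := by
  have hd : ∀ x : ℝ, HasDerivAt (fun x : ℝ => x ^ n * Real.exp (-x ^ 2 / 2))
      (n * (x ^ (n - 1) * Real.exp (-x ^ 2 / 2)) - x ^ (n + 1) * Real.exp (-x ^ 2 / 2)) x := by
    intro x
    have h1 := hasDerivAt_pow n x
    have h2 : HasDerivAt (fun x : ℝ => Real.exp (-x ^ 2 / 2))
        (Real.exp (-x ^ 2 / 2) * (-x)) x := by
      have h3 : HasDerivAt (fun x : ℝ => -x ^ 2 / 2) (-x) x := by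
        refine HasDerivAt.congr_deriv (((hasDerivAt_pow 2 x).neg).div_const 2) ?_
        push_cast
        ring
      exact h3.exp
    exact (h1.mul h2).congr_deriv (by ring)
  have h0 := integral_eq_zero_of_hasDerivAt_of_integrable hd
    (((integrable_pow_mul_gaussian (n - 1)).const_mul _).sub (integrable_pow_mul_gaussian (n + 1)))
    (integrable_pow_mul_gaussian n)
  rw [integral_sub ((integrable_pow_mul_gaussian (n - 1)).const_mul _)
    (integrable_pow_mul_gaussian (n + 1)), integral_const_mul] at h0
  unfold gaussMoment
  linarith

open MvPolynomial

variable {d : ℕ}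

/-- The density of the (unnormalized) standard Gaussian measure. -/
noncomputable def gaussWeight (x : Fin d → ℝ) : ℝ := Real.exp (-(∑ i, x i ^ 2) / 2)

/-- The integral of a polynomial against the (unnormalized) standard Gaussian measure. -/
noncomputable def gaussInt (p : MvPolynomial (Fin d) ℝ) : ℝ :=
  ∫ x : Fin d → ℝ, eval x p * gaussWeight x

lemma eval_monomial_mul_gaussWeight (a : Fin d →₀ ℕ) (c : ℝ) (x : Fin d → ℝ) :
    eval x (monomial a c) * gaussWeight x
      = c * ∏ i, (x i ^ a i * Real.exp (-x i ^ 2 / 2)) := by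
  rw [eval_monomial, Finsupp.prod_fintype _ _ (by simp), Finset.prod_mul_distrib, ← Real.exp_sum,
    gaussWeight, mul_assoc]
  congr 3
  rw [← Finset.sum_div, Finset.sum_neg_distrib]

lemma integrable_eval_mul_gaussWeight (p : MvPolynomial (Fin d) ℝ) :
    Integrable (fun x : Fin d → ℝ => eval x p * gaussWeight x) := by
  induction p using MvPolynomial.induction_on' with
  | monomial a c =>
    simp_rw [eval_monomial_mul_gaussWeight]
    exact (Integrable.fintype_prod (f := fun i (t : ℝ) => t ^ a i * Real.exp (-t ^ 2 / 2))
      fun i => integrable_pow_mul_gaussian (a i)).const_mul c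
  | add p q hp hq =>
    simp_rw [map_add, add_mul]
    exact hp.add hq

lemma gaussInt_monomial (a : Fin d →₀ ℕ) (c : ℝ) :
    gaussInt (monomial a c) = c * ∏ i, gaussMoment (a i) := by
  unfold gaussInt gaussMoment
  simp_rw [eval_monomial_mul_gaussWeight]
  rw [integral_const_mul]
  congr 1
  exact integral_fintype_prod_volume_eq_prod
    (fun i (t : ℝ) => t ^ a i * Real.exp (-t ^ 2 / 2))

lemma gaussInt_add (p q : MvPolynomial (Fin d) ℝ) :
    gaussInt (p + q) = gaussInt p + gaussInt q := by
  unfold gaussInt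
  simp_rw [map_add, add_mul]
  exact integral_add (integrable_eval_mul_gaussWeight p) (integrable_eval_mul_gaussWeight q)

lemma gaussInt_smul (c : ℝ) (p : MvPolynomial (Fin d) ℝ) :
    gaussInt (c • p) = c * gaussInt p := by
  unfold gaussInt
  simp_rw [smul_eval, mul_assoc]
  exact integral_const_mul _ _

/-- `gaussInt` as a linear functional. -/
noncomputable def gaussIntₗ : MvPolynomial (Fin d) ℝ →ₗ[ℝ] ℝ where
  toFun := gaussInt
  map_add' := gaussInt_add
  map_smul' := gaussInt_smul

/-- Gaussian integration by parts. -/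
lemma gaussInt_pderiv (i : Fin d) (p : MvPolynomial (Fin d) ℝ) :
    gaussInt (pderiv i p) = gaussInt (X i * p) := by
  induction p using MvPolynomial.induction_on' with
  | monomial a c =>
    have hX : X i * monomial a c = monomial (a + Finsupp.single i 1) c := by
      rw [← pow_one (X i), ← monomial_single_add, add_comm]
    rw [pderiv_monomial, hX, gaussInt_monomial,
      gaussInt_monomial]
    rw [Fintype.prod_eq_mul_prod_compl i, Fintype.prod_eq_mul_prod_compl i]
    have h1 : ∀ j ∈ ({i}ᶜ : Finset (Fin d)), gaussMoment ((a - Finsupp.single i 1 : Fin d →₀ ℕ) j)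
        = gaussMoment ((a + Finsupp.single i 1 : Fin d →₀ ℕ) j) := by
      intro j hj
      have hj : i ≠ j := by simpa [eq_comm] using hj
      simp [Finsupp.single_eq_of_ne' hj]
    rw [Finset.prod_congr rfl h1]
    simp [gaussMoment_succ]
    ring
  | add p q hp hq => rw [map_add, mul_add, gaussInt_add, gaussInt_add, hp, hq]

end GaussianMoments

/-! ### From Gaussian integrals to the sphere; orthogonality of harmonics -/

section SphereIntegral

open MvPolynomial

variable {d : ℕ}

/-- The restriction of a polynomial to the sphere. -/
noncomputable abbrev sphRestrict (d : ℕ) : MvPolynomial (Fin d) ℝ →ₐ[ℝ] C(Sph d, ℝ) :=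
  MvPolynomial.aeval (coordFn d)

lemma sphRestrict_apply (p : MvPolynomial (Fin d) ℝ) (x : Sph d) :
    sphRestrict d p x = eval (x : EuclideanSpace ℝ (Fin d)).ofLp p := by
  induction p using MvPolynomial.induction_on with
  | C a => simp [sphRestrict]
  | add p q hp hq => rw [map_add, map_add, ContinuousMap.add_apply, hp, hq]
  | mul_X p i hp =>
    rw [map_mul, map_mul, ContinuousMap.mul_apply, hp]
    simp [sphRestrict, coordFn]

lemma MvPolynomial.IsHomogeneous.eval_smul' {p : MvPolynomial (Fin d) ℝ} {n : ℕ}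
    (hp : p.IsHomogeneous n) (r : ℝ) (x : Fin d → ℝ) :
    eval (r • x) p = r ^ n * eval x p := by
  rw [eval_eq', eval_eq', Finset.mul_sum]
  refine Finset.sum_congr rfl fun a ha => ?_
  have hn : ∑ i, a i = n := by
    have := hp (mem_support_iff.mp ha)
    rw [Finsupp.weight_apply, Finsupp.sum_fintype _ _ (by simp)] at this
    simpa using this
  simp only [Pi.smul_apply, smul_eq_mul, mul_pow, Finset.prod_mul_distrib,
    Finset.prod_pow_eq_pow_sum, hn]
  ring

/-- The radial factor in polar coordinates for the Gaussian integral of a homogeneous polynomial. -/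
noncomputable def radialConst (d n : ℕ) : ℝ :=
  ∫ r : Set.Ioi (0 : ℝ), r.1 ^ n * Real.exp (-r.1 ^ 2 / 2) ∂Measure.volumeIoiPow (d - 1)

lemma radialConst_pos (d n : ℕ) : 0 < radialConst d n := by
  have h : radialConst d n
      = ∫ r in Set.Ioi (0 : ℝ), r ^ ((d - 1 + n : ℕ) : ℝ) * Real.exp (-(1 / 2) * r ^ (2 : ℝ)) := by
    simp only [radialConst, Measure.volumeIoiPow, ENNReal.ofReal]
    rw [integral_withDensity_eq_integral_smul,
      integral_subtype_comap measurableSet_Ioi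
        fun a ↦ Real.toNNReal (a ^ (d - 1)) • (a ^ n * Real.exp (-a ^ 2 / 2)),
      setIntegral_congr_fun measurableSet_Ioi fun x hx ↦ ?_]
    · have hx' : (0 : ℝ) < x := hx
      simp only [NNReal.smul_def]
      rw [Real.coe_toNNReal _ (pow_nonneg hx'.le _), Real.rpow_natCast, smul_eq_mul, pow_add,
        mul_assoc]
      congr 3
      rw [Real.rpow_ofNat]
      ring
    · exact (measurable_subtype_coe.pow_const _).real_toNNReal
  rw [h, integral_rpow_mul_exp_neg_mul_rpow (by norm_num)
    (by have := Nat.cast_nonneg (α := ℝ) (d - 1 + n); linarith) (by norm_num)]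
  have : 0 < Real.Gamma ((((d - 1 + n : ℕ) : ℝ) + 1) / 2) := Real.Gamma_pos_of_pos (by positivity)
  positivity

/-- In polar coordinates, homogeneity separates the integrand into an angular and a radial factor.
Since the radial factor is positive, orthogonality on the sphere can be checked on Gaussian
integrals. -/
lemma gaussInt_eq_toSphere [NeZero d] {p : MvPolynomial (Fin d) ℝ} {n : ℕ}
    (hp : p.IsHomogeneous n) :
    gaussInt p = (∫ x, sphRestrict d p x
      ∂(volume : Measure (EuclideanSpace ℝ (Fin d))).toSphere) * radialConst d n := by
  have : Nontrivial (EuclideanSpace ℝ (Fin d)) := by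
    have : Nonempty (Fin d) := ⟨0⟩
    infer_instance
  set μ := (volume : Measure (EuclideanSpace ℝ (Fin d)))
  have h1 : gaussInt p = ∫ y : EuclideanSpace ℝ (Fin d), eval y.ofLp p * gaussWeight y.ofLp ∂μ := by
    unfold gaussInt
    rw [← (PiLp.volume_preserving_toLp (Fin d)).integral_comp
      (MeasurableEquiv.toLp 2 (Fin d → ℝ)).measurableEmbedding]
  let F : Sph d × Set.Ioi (0 : ℝ) → ℝ := fun z =>
    sphRestrict d p z.1 * (z.2.1 ^ n * Real.exp (-z.2.1 ^ 2 / 2))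
  have h2 : ∫ y : EuclideanSpace ℝ (Fin d), eval y.ofLp p * gaussWeight y.ofLp ∂μ
      = ∫ y : ({(0)}ᶜ : Set (EuclideanSpace ℝ (Fin d))),
        F (homeomorphUnitSphereProd _ y) ∂(μ.comap (↑)) := by
    conv_lhs => rw [← restrict_compl_singleton (μ := μ) (0 : EuclideanSpace ℝ (Fin d))]
    rw [← integral_subtype_comap (measurableSet_singleton _).compl
      fun y : EuclideanSpace ℝ (Fin d) => eval y.ofLp p * gaussWeight y.ofLp]
    refine integral_congr_ae (Filter.Eventually.of_forall fun y => ?_)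
    simp only [F, sphRestrict_apply, homeomorphUnitSphereProd_apply_fst_coe,
      homeomorphUnitSphereProd_apply_snd_coe]
    have hy : ‖(y : EuclideanSpace ℝ (Fin d))‖ ≠ 0 := norm_ne_zero_iff.mpr y.2
    rw [WithLp.ofLp_smul, hp.eval_smul']
    have hw : gaussWeight (y : EuclideanSpace ℝ (Fin d)).ofLp
        = Real.exp (-‖(y : EuclideanSpace ℝ (Fin d))‖ ^ 2 / 2) := by
      rw [gaussWeight, EuclideanSpace.norm_sq_eq]
      simp
    rw [hw, inv_pow]
    field_simp
  have h3 := (μ.measurePreserving_homeomorphUnitSphereProd).integral_comp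
    (Homeomorph.measurableEmbedding _) F
  rw [h1, h2, h3, integral_prod_mul (fun x => sphRestrict d p x)
    (fun r : Set.Ioi (0 : ℝ) => r.1 ^ n * Real.exp (-r.1 ^ 2 / 2)), radialConst,
    finrank_euclideanSpace_fin]

lemma toSphere_univ_ne_zero [NeZero d] :
    (volume : Measure (EuclideanSpace ℝ (Fin d))).toSphere Set.univ ≠ 0 := by
  have : Nonempty (Fin d) := ⟨0⟩
  rw [Ne, Measure.measure_univ_eq_zero]
  exact Measure.toSphere_ne_zero _

instance unif_isProbabilityMeasure [NeZero d] : IsProbabilityMeasure (unif d) where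
  measure_univ := by
    rw [unif, Measure.smul_apply, smul_eq_mul]
    exact ENNReal.inv_mul_cancel toSphere_univ_ne_zero (measure_ne_top _ _)

instance unif_isOpenPosMeasure : (unif d).IsOpenPosMeasure :=
  Measure.isOpenPosMeasure_smul _ (ENNReal.inv_ne_zero.mpr (measure_ne_top _ _))

lemma integral_unif_eq_zero_of_gaussInt [NeZero d] {p : MvPolynomial (Fin d) ℝ} {n : ℕ}
    (hp : p.IsHomogeneous n) (h : gaussInt p = 0) : ∫ x, sphRestrict d p x ∂(unif d) = 0 := by
  rw [gaussInt_eq_toSphere hp] at h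
  rw [unif, integral_smul_measure, (mul_eq_zero.mp h).resolve_right (radialConst_pos d n).ne',
    smul_zero]

lemma polyLaplacian_apply (p : MvPolynomial (Fin d) ℝ) :
    polyLaplacian d p = ∑ i, pderiv i (pderiv i p) := by
  simp [polyLaplacian]

/-- The quadratic form of the Ornstein-Uhlenbeck operator on harmonic homogeneous polynomials. -/
lemma mul_gaussInt_mul_of_harmonic {p q : MvPolynomial (Fin d) ℝ} {k : ℕ}
    (hp : p.IsHomogeneous k) (hΔ : polyLaplacian d p = 0) :
    k * gaussInt (p * q) = ∑ i, gaussInt (pderiv i p * pderiv i q) := by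
  -- Integration by parts for `(∂ᵢp) q`. After summing over `i`, the second derivatives cancel
  -- because `p` is harmonic, and Euler's identity replaces `∑ Xᵢ ∂ᵢp` by `k p`.
  have h1 : ∀ i : Fin d, gaussInt (pderiv i (pderiv i p) * q) + gaussInt (pderiv i p * pderiv i q)
      = gaussInt (X i * pderiv i p * q) := by
    intro i
    have := gaussInt_pderiv i (pderiv i p * q)
    rw [Derivation.leibniz, gaussInt_add, smul_eq_mul, smul_eq_mul] at this
    rw [mul_assoc, ← this, mul_comm q, add_comm]
  have h2 := Finset.sum_congr rfl fun (i : Fin d) (_ : i ∈ Finset.univ) => h1 i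
  rw [Finset.sum_add_distrib] at h2
  have hs : ∀ f : Fin d → MvPolynomial (Fin d) ℝ, ∑ i, gaussInt (f i) = gaussInt (∑ i, f i) :=
    fun f => (map_sum gaussIntₗ f Finset.univ).symm
  have h3 : ∑ i, gaussInt (pderiv i (pderiv i p) * q) = 0 := by
    rw [hs, ← Finset.sum_mul, ← polyLaplacian_apply, hΔ, zero_mul]
    exact map_zero gaussIntₗ
  have h4 : ∑ i, gaussInt (X i * pderiv i p * q) = k * gaussInt (p * q) := by
    rw [hs, ← Finset.sum_mul, hp.sum_X_mul_pderiv, smul_mul_assoc, ← gaussInt_smul,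
      Nat.cast_smul_eq_nsmul]
  rw [h3, h4, zero_add] at h2
  exact h2.symm

/-- Spherical harmonics of different degrees are orthogonal. -/
lemma integral_mul_eq_zero_of_harmonics [NeZero d] {k l : ℕ} (hkl : k ≠ l) {g h : C(Sph d, ℝ)}
    (hg : g ∈ harmonics d k) (hh : h ∈ harmonics d l) : ∫ x, g x * h x ∂(unif d) = 0 := by
  obtain ⟨p, ⟨hp, hpΔ⟩, rfl⟩ := hg
  obtain ⟨q, ⟨hq, hqΔ⟩, rfl⟩ := hh
  have hp : p.IsHomogeneous k := hp
  have hq : q.IsHomogeneous l := hq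
  have h1 := mul_gaussInt_mul_of_harmonic (q := q) hp hpΔ
  have h2 := mul_gaussInt_mul_of_harmonic (q := p) hq hqΔ
  -- The gradient form is symmetric in `p` and `q`, so the two degrees act as eigenvalues of one
  -- symmetric operator.
  have h3 : (k - l : ℝ) * gaussInt (p * q) = 0 := by
    rw [mul_comm q p] at h2
    simp_rw [mul_comm (pderiv _ q)] at h2
    rw [sub_mul, h1, h2, sub_self]
  have h4 : gaussInt (p * q) = 0 :=
    (mul_eq_zero.mp h3).resolve_left (sub_ne_zero.mpr (by exact_mod_cast hkl))
  have h5 := integral_unif_eq_zero_of_gaussInt (hp.mul hq) h4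
  rw [← h5]
  simp [map_mul]

end SphereIntegral

/-! ### Decomposition of polynomials into harmonics, dimension, completeness -/

section Decomposition

open MvPolynomial

variable {d : ℕ}

lemma inner_toL2 (f g : C(Sph d, ℝ)) :
    inner ℝ (toL2 d f) (toL2 d g) = ∫ x, f x * g x ∂(unif d) := by
  rw [toL2, ContinuousMap.inner_toLp]
  simp [mul_comm]

lemma toL2_injective : Function.Injective (toL2 d) := ContinuousMap.toLp_injective (unif d)

lemma harmonics_le_harmonicsLE {l k : ℕ} (h : l ≤ k) : harmonics d l ≤ harmonicsLE d k :=
  le_iSup₂_of_le l h le_rfl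

lemma harmonicsLE_mono {l k : ℕ} (h : l ≤ k) : harmonicsLE d l ≤ harmonicsLE d k :=
  iSup₂_le fun _ hm => harmonics_le_harmonicsLE (hm.trans h)

lemma inner_harmonics_eq_zero [NeZero d] {k l : ℕ} (hkl : k ≠ l) {g h : C(Sph d, ℝ)}
    (hg : g ∈ harmonics d k) (hh : h ∈ harmonics d l) : inner ℝ (toL2 d g) (toL2 d h) = 0 := by
  rw [inner_toL2, integral_mul_eq_zero_of_harmonics hkl hg hh]

/-- A vector orthogonal to all harmonics of degree at most `k` is orthogonal to `harmonicsLE`. -/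
lemma inner_harmonicsLE_eq_zero {k : ℕ} {v : L2Sph d}
    (hv : ∀ l ≤ k, ∀ h ∈ harmonics d l, inner ℝ v (toL2 d h) = 0) {g : C(Sph d, ℝ)}
    (hg : g ∈ harmonicsLE d k) : inner ℝ v (toL2 d g) = 0 := by
  let φ : C(Sph d, ℝ) →ₗ[ℝ] ℝ := (innerSL ℝ v).toLinearMap ∘ₗ (toL2 d).toLinearMap
  have : harmonicsLE d k ≤ LinearMap.ker φ :=
    iSup₂_le fun l hl h hh => LinearMap.mem_ker.mpr (hv l hl h hh)
  exact this hg

lemma polyLaplacian_isHomogeneous {p : MvPolynomial (Fin d) ℝ} {m : ℕ}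
    (hp : p.IsHomogeneous (m + 2)) : (polyLaplacian d p).IsHomogeneous m := by
  rw [polyLaplacian_apply]
  exact IsHomogeneous.sum _ _ _ fun i _ => hp.pderiv.pderiv

lemma polyLaplacian_eq_zero_of_le_one {p : MvPolynomial (Fin d) ℝ} {k : ℕ}
    (hp : p.IsHomogeneous k) (hk : k ≤ 1) : polyLaplacian d p = 0 := by
  rw [polyLaplacian_apply]
  refine Finset.sum_eq_zero fun i _ => ?_
  have h : (pderiv i p).IsHomogeneous 0 := by
    have := hp.pderiv (i := i)
    rwa [Nat.sub_eq_zero_of_le hk] at this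
  rw [← totalDegree_zero_iff_isHomogeneous, totalDegree_eq_zero_iff_eq_C] at h
  rw [h, pderiv_C]

lemma eq_zero_of_sphRestrict_eq_zero [NeZero d] {p : MvPolynomial (Fin d) ℝ} {k : ℕ}
    (hp : p.IsHomogeneous k) (h : sphRestrict d p = 0) : p = 0 := by
  refine hp.eq_zero_of_forall_eval_eq_zero fun x => ?_
  obtain ⟨r, y, hy⟩ : ∃ (r : ℝ) (y : Sph d), x = r • (y : EuclideanSpace ℝ (Fin d)).ofLp := by
    by_cases hx : WithLp.toLp 2 x = 0
    · refine ⟨0, ⟨EuclideanSpace.single 0 1, by simp⟩, ?_⟩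
      have := congrArg WithLp.ofLp hx
      simpa using this
    · refine ⟨‖WithLp.toLp 2 x‖, ⟨‖WithLp.toLp 2 x‖⁻¹ • WithLp.toLp 2 x, ?_⟩, ?_⟩
      · simp [norm_smul, hx]
      · have : ‖WithLp.toLp 2 x‖ ≠ 0 := norm_ne_zero_iff.mpr hx
        simp [smul_smul, this]
  rw [hy, hp.eval_smul', ← sphRestrict_apply, h]
  simp

/-- The squared Euclidean norm as a polynomial. -/
noncomputable def normSqPoly (d : ℕ) : MvPolynomial (Fin d) ℝ := ∑ i, X i ^ 2

lemma normSqPoly_isHomogeneous : (normSqPoly d).IsHomogeneous 2 :=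
  IsHomogeneous.sum _ _ _ fun i _ => by simpa using (isHomogeneous_X ℝ i).pow 2

lemma sphRestrict_normSqPoly : sphRestrict d (normSqPoly d) = 1 := by
  ext x
  rw [sphRestrict_apply, normSqPoly, map_sum]
  have h : ‖(x : EuclideanSpace ℝ (Fin d))‖ ^ 2 = 1 := by
    rw [norm_eq_of_mem_sphere x, one_pow]
  rw [EuclideanSpace.norm_sq_eq] at h
  simpa using h

/-- The restriction of a homogeneous polynomial to the sphere is a sum of spherical harmonics. -/
lemma sphRestrict_mem_harmonicsLE [NeZero d] (k : ℕ) {p : MvPolynomial (Fin d) ℝ}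
    (hp : p.IsHomogeneous k) : sphRestrict d p ∈ harmonicsLE d k := by
  induction k using Nat.strong_induction_on generalizing p with
  | _ k ih =>
  by_cases hk : k ≤ 1
  · exact harmonics_le_harmonicsLE le_rfl ⟨p, ⟨hp, polyLaplacian_eq_zero_of_le_one hp hk⟩, rfl⟩
  obtain ⟨m, rfl⟩ : ∃ m, k = m + 2 := ⟨k - 2, by omega⟩
  have hmul : ∀ {r : MvPolynomial (Fin d) ℝ}, r.IsHomogeneous m →
      (normSqPoly d * r).IsHomogeneous (m + 2) := fun hr => by
    rw [add_comm]
    exact normSqPoly_isHomogeneous.mul hr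
  -- Fischer decomposition: if `r ↦ Δ(|x|² r)` is onto in degree `m`, some `r` makes `p - |x|² r`
  -- harmonic, and `|x|² r` restricts to `r`. In finite dimension injectivity suffices.
  let T : homogeneousSubmodule (Fin d) ℝ m →ₗ[ℝ] homogeneousSubmodule (Fin d) ℝ m :=
    (polyLaplacian d ∘ₗ LinearMap.mulLeft ℝ (normSqPoly d)).restrict
      fun r hr => polyLaplacian_isHomogeneous (hmul hr)
  have : FiniteDimensional ℝ (homogeneousSubmodule (Fin d) ℝ m) :=
    Module.Finite.iff_fg.mpr (homogeneousSubmodule_fg (Fin d) ℝ m)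
  have hinj : Function.Injective T := by
    rw [← LinearMap.ker_eq_bot, LinearMap.ker_eq_bot']
    rintro ⟨r, hr⟩ hTr
    have hr' : r.IsHomogeneous m := hr
    have hΔ : polyLaplacian d (normSqPoly d * r) = 0 := congrArg Subtype.val hTr
    -- A kernel element `r` restricts both to a harmonic of degree `m + 2` and, by induction, to a
    -- sum of harmonics of degree at most `m`; it is thus orthogonal to itself.
    have hmem : sphRestrict d r ∈ harmonics d (m + 2) := by
      refine ⟨normSqPoly d * r, ⟨hmul hr', hΔ⟩, ?_⟩
      change sphRestrict d (normSqPoly d * r) = _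
      rw [map_mul, sphRestrict_normSqPoly, one_mul]
    have h0 : inner ℝ (toL2 d (sphRestrict d r)) (toL2 d (sphRestrict d r)) = 0 :=
      inner_harmonicsLE_eq_zero
        (fun l hl h hh => inner_harmonics_eq_zero (by omega) hmem hh) (ih m (by omega) hr')
    have h1 : sphRestrict d r = 0 :=
      toL2_injective ((inner_self_eq_zero.mp h0).trans (map_zero _).symm)
    exact Subtype.ext (eq_zero_of_sphRestrict_eq_zero hr' h1)
  obtain ⟨⟨r, hr⟩, hTr⟩ := LinearMap.injective_iff_surjective.mp hinj
    ⟨polyLaplacian d p, polyLaplacian_isHomogeneous hp⟩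
  have hr' : r.IsHomogeneous m := hr
  have hΔ : polyLaplacian d (normSqPoly d * r) = polyLaplacian d p := congrArg Subtype.val hTr
  have hsplit : sphRestrict d p = sphRestrict d (p - normSqPoly d * r) + sphRestrict d r := by
    rw [map_sub, map_mul, sphRestrict_normSqPoly, one_mul, sub_add_cancel]
  rw [hsplit]
  refine add_mem (harmonics_le_harmonicsLE le_rfl ⟨_, ⟨hp.sub (hmul hr'), ?_⟩, rfl⟩)
    (harmonicsLE_mono (by omega) (ih m (by omega) hr'))
  rw [SetLike.mem_coe, LinearMap.mem_ker, map_sub, hΔ, sub_self]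

lemma harmonicsLE_eq_map [NeZero d] (k : ℕ) :
    harmonicsLE d k = (restrictTotalDegree (Fin d) ℝ k).map (sphRestrict d).toLinearMap := by
  refine le_antisymm (iSup₂_le fun l hl => ?_) ?_
  · rintro _ ⟨p, ⟨hp, -⟩, rfl⟩
    exact ⟨p, (mem_restrictTotalDegree _ _ _).mpr
      ((IsHomogeneous.totalDegree_le hp).trans hl), rfl⟩
  · rintro _ ⟨p, hp, rfl⟩
    have hp : p.totalDegree ≤ k := (mem_restrictTotalDegree _ _ _).mp hp
    change sphRestrict d p ∈ _
    rw [← sum_homogeneousComponent p, map_sum]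
    refine Submodule.sum_mem _ fun i hi => ?_
    exact harmonicsLE_mono (by have := Finset.mem_range.mp hi; omega)
      (sphRestrict_mem_harmonicsLE i (homogeneousComponent_isHomogeneous i p))

instance harmonicsLE_finite [NeZero d] (k : ℕ) : FiniteDimensional ℝ (harmonicsLE d k) := by
  rw [harmonicsLE_eq_map]
  infer_instance

lemma finrank_restrictTotalDegree_le [NeZero d] (k : ℕ) :
    Module.finrank ℝ (restrictTotalDegree (Fin d) ℝ k) ≤ (k + 1) * (d + k - 1).choose k := by
  rw [restrictTotalDegree, Module.finrank_eq_nat_card_basis (basisRestrictSupport ℝ _),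
    Nat.card_coe_set_eq]
  have hsub : {n : Fin d →₀ ℕ | (n.sum fun _ e => e) ≤ k}
      ⊆ ((Finset.range (k + 1)).biUnion fun m => Finset.univ.finsuppAntidiag m :
        Finset (Fin d →₀ ℕ)) := by
    intro n hn
    have hn' : (n.sum fun _ e => e) ≤ k := hn
    rw [Finsupp.sum_fintype _ _ (by simp)] at hn'
    simp only [Finset.coe_biUnion, Set.mem_iUnion, Finset.mem_coe, Finset.mem_range,
      Finset.mem_finsuppAntidiag]
    exact ⟨_, Nat.lt_succ_of_le hn', rfl, Finset.subset_univ _⟩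
  refine (Set.ncard_le_ncard hsub (Finset.finite_toSet _)).trans ?_
  rw [Set.ncard_coe_finset]
  refine Finset.card_biUnion_le.trans ?_
  have hd : 1 ≤ d := NeZero.one_le
  calc _ ≤ ∑ _m ∈ Finset.range (k + 1), (d + k - 1).choose k := by
        refine Finset.sum_le_sum fun m hm => ?_
        have hm : m ≤ k := by have := Finset.mem_range.mp hm; omega
        rw [Finset.card_finsuppAntidiag_nat_eq_choose, Finset.card_univ, Fintype.card_fin,
          Nat.choose_symm_of_eq_add (show d + m - 1 = m + (d - 1) by omega),
          Nat.choose_symm_of_eq_add (show d + k - 1 = k + (d - 1) by omega)]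
        exact Nat.choose_le_choose _ (by omega)
    _ = _ := by simp

lemma finrank_harmonicsLE_le [NeZero d] (k : ℕ) :
    Module.finrank ℝ (harmonicsLE d k) ≤ (k + 1) * (d + k - 1).choose k := by
  rw [harmonicsLE_eq_map]
  exact (Submodule.finrank_map_le _ _).trans (finrank_restrictTotalDegree_le k)

lemma topologicalClosure_range_sphRestrict :
    (sphRestrict d).range.topologicalClosure = ⊤ := by
  refine ContinuousMap.subalgebra_topologicalClosure_eq_top_of_separatesPoints _ fun x y hxy => ?_
  obtain ⟨i, hi⟩ : ∃ i, (x : EuclideanSpace ℝ (Fin d)) i ≠ (y : EuclideanSpace ℝ (Fin d)) i := by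
    by_contra! h
    exact hxy (Subtype.ext (PiLp.ext h))
  exact ⟨_, ⟨_, ⟨X i, rfl⟩, rfl⟩, by simpa [coordFn] using hi⟩

/-- A square integrable function orthogonal to all spherical harmonics vanishes. -/
lemma eq_zero_of_forall_inner_harmonics [NeZero d] {v : L2Sph d}
    (hv : ∀ l, ∀ h ∈ harmonics d l, inner ℝ v (toL2 d h) = 0) : v = 0 := by
  have h1 : ∀ g : C(Sph d, ℝ), inner ℝ v (toL2 d g) = 0 := by
    intro g
    have hcl : IsClosed {g : C(Sph d, ℝ) | inner ℝ v (toL2 d g) = 0} :=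
      isClosed_eq (by fun_prop) continuous_const
    have hg : g ∈ closure ((sphRestrict d).range : Set C(Sph d, ℝ)) := by
      have : g ∈ (sphRestrict d).range.topologicalClosure := by
        rw [topologicalClosure_range_sphRestrict]
        trivial
      exact this
    refine hcl.closure_subset_iff.mpr ?_ hg
    rintro _ ⟨p, rfl⟩
    refine inner_harmonicsLE_eq_zero (k := p.totalDegree) (fun l _ => hv l) ?_
    rw [harmonicsLE_eq_map]
    exact ⟨p, (mem_restrictTotalDegree _ _ _).mpr le_rfl, rfl⟩
  have h2 : DenseRange (toL2 d) := ContinuousMap.toLp_denseRange ℝ (unif d) ℝ (by simp)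
  have h3 : inner ℝ v v = 0 :=
    h2.induction_on (p := fun w => inner ℝ v w = 0) v
      (isClosed_eq (by fun_prop) continuous_const) h1
  exact inner_self_eq_zero.mp h3

end Decomposition

/-! ### Projections, uniform truncation, existence of minimizers -/

section Projections

variable {d : ℕ}

lemma exists_harmonics_toL2_eq_harmProj (l : ℕ) (f : L2Sph d) :
    ∃ p ∈ harmonics d l, toL2 d p = harmProj d l f := by
  obtain ⟨p, hp, h⟩ := (harmonicsL2 d l).starProjection_apply_mem f
  exact ⟨p, hp, h⟩

lemma harmProj_toL2_of_mem {l : ℕ} {p : C(Sph d, ℝ)} (hp : p ∈ harmonics d l) :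
    harmProj d l (toL2 d p) = toL2 d p :=
  Submodule.starProjection_eq_self_iff.mpr ⟨p, hp, rfl⟩

lemma harmProj_toL2_of_mem_of_ne [NeZero d] {l k : ℕ} (hlk : l ≠ k) {p : C(Sph d, ℝ)}
    (hp : p ∈ harmonics d l) : harmProj d k (toL2 d p) = 0 := by
  refine (Submodule.starProjection_apply_eq_zero_iff _).mpr ?_
  rintro _ ⟨q, hq, rfl⟩
  exact inner_harmonics_eq_zero hlk.symm hq hp

lemma inner_harmProj (l : ℕ) (f : L2Sph d) {h : C(Sph d, ℝ)} (hh : h ∈ harmonics d l) :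
    inner ℝ (harmProj d l f) (toL2 d h) = inner ℝ f (toL2 d h) := by
  have := (harmonicsL2 d l).starProjection_inner_eq_zero f (toL2 d h) ⟨h, hh, rfl⟩
  rw [inner_sub_left, sub_eq_zero] at this
  exact this.symm

lemma ae_toL2 (g : C(Sph d, ℝ)) : toL2 d g =ᵐ[unif d] g := ContinuousMap.coeFn_toLp (unif d) g

lemma forall_of_ae_of_isClosed {s : Set (Sph d)} (hs : IsClosed s) (h : ∀ᵐ x ∂(unif d), x ∈ s)
    (x : Sph d) : x ∈ s := by
  have : s = Set.univ := (hs.ae_eq_univ_iff_eq (μ := unif d)).mp (Filter.eventuallyEq_univ.mpr h)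
  rw [this]
  trivial

lemma norm_le_of_eLpNorm_toL2_le {g : C(Sph d, ℝ)} {C : ℝ} (hC : 0 ≤ C)
    (h : eLpNorm (toL2 d g) ∞ (unif d) ≤ ENNReal.ofReal C) : ‖g‖ ≤ C := by
  rw [eLpNorm_congr_ae (ae_toL2 g), eLpNorm_exponent_top] at h
  refine (ContinuousMap.norm_le g hC).mpr fun x => ?_
  refine forall_of_ae_of_isClosed (s := {x | ‖g x‖ ≤ C})
    (isClosed_le (by fun_prop) continuous_const) ?_ x
  filter_upwards [ae_le_eLpNormEssSup (f := g) (μ := unif d)] with y hy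
  have := hy.trans h
  rwa [← ofReal_norm, ENNReal.ofReal_le_ofReal_iff hC] at this

/-- A square integrable function whose harmonic components have summable sup norms agrees with a
continuous function, which is approximated uniformly by its truncated harmonic expansion. -/
lemma exists_continuous_truncation [NeZero d] (f : L2Sph d) {b : ℕ → ℝ} (hb : Summable b)
    (hb0 : ∀ l, 0 ≤ b l)
    (hf : ∀ l, eLpNorm (harmProj d l f) ∞ (unif d) ≤ ENNReal.ofReal (b l)) (k : ℕ) :
    ∃ F G : C(Sph d, ℝ), toL2 d F = f ∧ G ∈ harmonicsLE d k ∧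
      (∀ l ≤ k, harmProj d l (toL2 d G) = harmProj d l f) ∧
      (∀ h ∈ harmonicsLE d k, ∫ x, (F x - G x) * h x ∂(unif d) = 0) ∧
      ∀ x, |F x - G x| ≤ ∑' l, b (l + (k + 1)) := by
  choose p hp hpf using fun l => exists_harmonics_toL2_eq_harmProj l f
  have hpb : ∀ l, ‖p l‖ ≤ b l := fun l =>
    norm_le_of_eLpNorm_toL2_le (hb0 l) (by rw [hpf]; exact hf l)
  have hps : Summable p := Summable.of_norm_bounded hb hpb
  obtain ⟨F, hF⟩ := hps
  have hFL : HasSum (fun l => toL2 d (p l)) (toL2 d F) := (toL2 d).hasSum hF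
  -- The uniform limit `F` has the same inner products as `f` with every harmonic, so completeness
  -- identifies them in `L²`.
  have hinF : ∀ l, ∀ h ∈ harmonics d l, inner ℝ (toL2 d F) (toL2 d h) = inner ℝ f (toL2 d h) := by
    intro l h hh
    have h1 : HasSum (fun m => inner ℝ (toL2 d (p m)) (toL2 d h))
        (inner ℝ (toL2 d F) (toL2 d h)) := by
      have := (innerSL ℝ (toL2 d h)).hasSum hFL
      simpa only [innerSL_apply_apply, real_inner_comm] using this
    have h2 := hasSum_single (f := fun m => inner ℝ (toL2 d (p m)) (toL2 d h)) l
      fun m hm => inner_harmonics_eq_zero hm (hp m) hh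
    rw [h1.unique h2, hpf, inner_harmProj l f hh]
  have hFf : toL2 d F = f := by
    rw [← sub_eq_zero]
    refine eq_zero_of_forall_inner_harmonics fun l h hh => ?_
    rw [inner_sub_left, hinF l h hh, sub_self]
  refine ⟨F, ∑ l ∈ Finset.range (k + 1), p l, hFf, ?_, ?_, ?_, ?_⟩
  · exact Submodule.sum_mem _ fun l hl =>
      harmonics_le_harmonicsLE (by have := Finset.mem_range.mp hl; omega) (hp l)
  · intro l hl
    rw [map_sum, map_sum, Finset.sum_eq_single l]
    · rw [harmProj_toL2_of_mem (hp l), hpf]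
    · exact fun m _ hm => harmProj_toL2_of_mem_of_ne hm (hp m)
    · exact fun h => absurd (Finset.mem_range.mpr (by omega)) h
  · intro h hh
    have := inner_harmonicsLE_eq_zero (k := k)
      (v := toL2 d (F - ∑ l ∈ Finset.range (k + 1), p l)) (fun l hl q hq => ?_) hh
    · rw [inner_toL2] at this
      exact this
    · rw [map_sub, inner_sub_left, hinF l q hq, map_sum, sum_inner, Finset.sum_eq_single l]
      · rw [hpf, inner_harmProj l f hq, sub_self]
      · exact fun m _ hm => inner_harmonics_eq_zero hm (hp m) hq
      · exact fun h => absurd (Finset.mem_range.mpr (by omega)) h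
  · intro x
    have h1 : HasSum (fun l => p (l + (k + 1))) (F - ∑ l ∈ Finset.range (k + 1), p l) :=
      (hasSum_nat_add_iff' (k + 1)).mpr hF
    have h2 : ‖F - ∑ l ∈ Finset.range (k + 1), p l‖ ≤ ∑' l, b (l + (k + 1)) := by
      rw [← h1.tsum_eq]
      exact tsum_of_norm_bounded ((summable_nat_add_iff (k + 1)).mpr hb).hasSum fun l => hpb _
    exact (ContinuousMap.norm_coe_le_norm (F - ∑ l ∈ Finset.range (k + 1), p l) x).trans h2

/-- Empirical risk minimizers over the function class exist. -/
lemma exists_isMinOn_funClass [NeZero d] {c₁ : ℝ} (hc : 0 ≤ c₁) (k : ℕ) {n : ℕ}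
    (D : Fin n → Sph d × ℝ) :
    ∃ g ∈ funClass d c₁ k, ∀ h ∈ funClass d c₁ k,
      ∑ i, (g (D i).1 - (D i).2) ^ 2 ≤ ∑ i, (h (D i).1 - (D i).2) ^ 2 := by
  -- The map collecting all components is injective on a finite-dimensional space, hence
  -- antilipschitz. So the bounds on the components cut out a compact set.
  let A : harmonicsLE d k →L[ℝ] (Fin (k + 1) → L2Sph d) := ContinuousLinearMap.pi fun l =>
    (harmProj d l).comp ((toL2 d).comp (harmonicsLE d k).subtypeL)
  have hker : LinearMap.ker A.toLinearMap = ⊥ := by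
    rw [LinearMap.ker_eq_bot']
    rintro ⟨g, hg⟩ hAg
    have h0 : inner ℝ (toL2 d g) (toL2 d g) = 0 := by
      refine inner_harmonicsLE_eq_zero (k := k) (fun l hl h hh => ?_) hg
      have : harmProj d l (toL2 d g) = 0 := congrFun hAg ⟨l, by omega⟩
      rw [← inner_harmProj l _ hh, this, inner_zero_left]
    exact Subtype.ext (toL2_injective ((inner_self_eq_zero.mp h0).trans (map_zero _).symm))
  obtain ⟨K, -, hK⟩ := LinearMap.exists_antilipschitzWith (𝕜 := ℝ)
    (E := harmonicsLE d k) (F := Fin (k + 1) → L2Sph d) A.toLinearMap hker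
  have : ProperSpace (harmonicsLE d k) := FiniteDimensional.proper_real _
  let S : Set (harmonicsLE d k) := A ⁻¹' Metric.closedBall 0 c₁
  have hS : IsCompact S := Metric.isCompact_of_isClosed_isBounded
    (Metric.isClosed_closedBall.preimage A.continuous) (hK.isBounded_preimage Metric.isBounded_closedBall)
  have hmem : ∀ g : harmonicsLE d k, g ∈ S ↔ (g : C(Sph d, ℝ)) ∈ funClass d c₁ k := by
    intro g
    simp only [S, Set.mem_preimage, mem_closedBall_zero_iff, pi_norm_le_iff_of_nonneg hc, funClass,
      Set.mem_ofPred_eq]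
    refine ⟨fun h => ⟨g.2, fun l hl => h ⟨l, by omega⟩⟩, fun h i => h.2 i (by omega)⟩
  have hcont : Continuous fun g : harmonicsLE d k =>
      ∑ i, ((g : C(Sph d, ℝ)) (D i).1 - (D i).2) ^ 2 := by
    refine continuous_finsetSum _ fun i _ => ?_
    have : Continuous fun g : harmonicsLE d k => (g : C(Sph d, ℝ)) (D i).1 :=
      (continuous_eval_const (F := C(Sph d, ℝ)) (D i).1).comp continuous_subtype_val
    fun_prop
  obtain ⟨g, hg, hmin⟩ := hS.exists_isMinOn
    ⟨0, by simp [S, hc]⟩ hcont.continuousOn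
  exact ⟨g, (hmem g).mp hg, fun h hh => hmin ((hmem ⟨h, hh.1⟩).mpr hh)⟩

end Projections

/-! ### Rotation invariance and the diagonal of the reproducing kernel -/

section Rotation

open MvPolynomial

variable {d : ℕ}

/-- The action of a linear isometry on the sphere. -/
noncomputable def sphIsometry (R : EuclideanSpace ℝ (Fin d) ≃ₗᵢ[ℝ] EuclideanSpace ℝ (Fin d)) :
    C(Sph d, Sph d) where
  toFun x := ⟨R x, by simp⟩
  continuous_toFun := by fun_prop

lemma coe_sphIsometry (R : EuclideanSpace ℝ (Fin d) ≃ₗᵢ[ℝ] EuclideanSpace ℝ (Fin d)) (x : Sph d) :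
    (sphIsometry R x : EuclideanSpace ℝ (Fin d)) = R x := rfl

open scoped Pointwise in
-- The surface measure of a set is a multiple of the volume of the cone over it, and a linear
-- isometry preserves volume and maps cones to cones.
lemma measurePreserving_sphIsometry
    (R : EuclideanSpace ℝ (Fin d) ≃ₗᵢ[ℝ] EuclideanSpace ℝ (Fin d)) :
    MeasurePreserving (sphIsometry R) (unif d) (unif d) := by
  have hm : Measurable (sphIsometry R) := (sphIsometry R).continuous.measurable
  refine MeasurePreserving.smul_measure ⟨hm, ?_⟩ _
  ext s hs
  rw [Measure.map_apply hm hs, Measure.toSphere_apply' _ hs, Measure.toSphere_apply' _ (hm hs)]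
  congr 1
  have hR := (LinearIsometryEquiv.measurePreserving R).measure_preimage_equiv
    (f := R.toHomeomorph.toMeasurableEquiv)
    (Set.Ioo (0 : ℝ) 1 • ((↑) '' s : Set (EuclideanSpace ℝ (Fin d))))
  refine Eq.trans ?_ hR
  congr 1
  ext x
  simp only [Set.mem_smul, Set.mem_image, Set.mem_preimage]
  constructor
  · rintro ⟨r, hr, _, ⟨y, hy, rfl⟩, rfl⟩
    exact ⟨r, hr, _, ⟨_, hy, rfl⟩, (map_smul R r _).symm⟩
  · rintro ⟨r, hr, _, ⟨y, hy, rfl⟩, hx⟩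
    have hx' : r • (y : EuclideanSpace ℝ (Fin d)) = R x := hx
    refine ⟨r, hr, _, ⟨sphIsometry R.symm y, ?_, rfl⟩, ?_⟩
    · have : sphIsometry R (sphIsometry R.symm y) = y := Subtype.ext (by simp [coe_sphIsometry])
      rwa [this]
    · rw [coe_sphIsometry, ← map_smul, hx', R.symm_apply_apply]

/-- The linear isometries act transitively on the sphere. -/
lemma exists_sphIsometry_eq (x y : Sph d) :
    ∃ R : EuclideanSpace ℝ (Fin d) ≃ₗᵢ[ℝ] EuclideanSpace ℝ (Fin d), sphIsometry R x = y := by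
  refine ⟨(ℝ ∙ ((x : EuclideanSpace ℝ (Fin d)) - y))ᗮ.reflection, Subtype.ext ?_⟩
  exact Submodule.reflection_sub (by rw [norm_eq_of_mem_sphere, norm_eq_of_mem_sphere])

/-- Composition with `R` is a linear substitution, which preserves homogeneity. Harmonicity need not
be tracked, as every homogeneous polynomial restricts into `harmonicsLE`. -/
lemma comp_sphIsometry_mem_harmonicsLE [NeZero d] {k : ℕ}
    (R : EuclideanSpace ℝ (Fin d) ≃ₗᵢ[ℝ] EuclideanSpace ℝ (Fin d)) {g : C(Sph d, ℝ)}
    (hg : g ∈ harmonicsLE d k) : g.comp (sphIsometry R) ∈ harmonicsLE d k := by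
  let L : Fin d → MvPolynomial (Fin d) ℝ := fun i =>
    ∑ j, C (R (EuclideanSpace.single j 1) i) * X j
  have hL : ∀ i, (L i).IsHomogeneous 1 := fun i =>
    IsHomogeneous.sum _ _ _ fun j _ => isHomogeneous_C_mul_X _ _
  have hcomp : (sphRestrict d).comp (aeval L)
      = (ContinuousMap.compRightAlgHom ℝ ℝ (sphIsometry R)).comp (sphRestrict d) := by
    refine MvPolynomial.algHom_ext fun i => ?_
    ext x
    simp only [AlgHom.comp_apply, aeval_X]
    rw [sphRestrict_apply]
    simp only [L, map_sum, map_mul, eval_C, eval_X, ContinuousMap.compRightAlgHom_apply,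
      ContinuousMap.comp_apply]
    change _ = (R x : EuclideanSpace ℝ (Fin d)) i
    have hx : (x : EuclideanSpace ℝ (Fin d)) = ∑ j, (x : EuclideanSpace ℝ (Fin d)) j •
        EuclideanSpace.single j (1 : ℝ) := by
      ext i
      simp [Finset.sum_apply, Pi.single_apply]
    conv_rhs => rw [hx, map_sum]
    simp [mul_comm]
  have hle : harmonicsLE d k ≤ (harmonicsLE d k).comap
      (ContinuousMap.compRightAlgHom ℝ ℝ (sphIsometry R)).toLinearMap := by
    refine iSup₂_le fun l hl => ?_
    rintro _ ⟨p, ⟨hp, -⟩, rfl⟩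
    have hp : p.IsHomogeneous l := hp
    refine harmonicsLE_mono hl ?_
    have h1 := sphRestrict_mem_harmonicsLE (d := d) (1 * l) (hp.aeval L hL)
    rw [one_mul] at h1
    have h2 := DFunLike.congr_fun hcomp p
    simp only [AlgHom.comp_apply] at h2
    rw [h2] at h1
    exact h1
  exact hle hg

lemma inner_comp_sphIsometry (R : EuclideanSpace ℝ (Fin d) ≃ₗᵢ[ℝ] EuclideanSpace ℝ (Fin d))
    (g h : C(Sph d, ℝ)) :
    ∫ x, g (sphIsometry R x) * h (sphIsometry R x) ∂(unif d) = ∫ x, g x * h x ∂(unif d) := by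
  have hm := measurePreserving_sphIsometry R
  have := integral_map (μ := unif d) (φ := sphIsometry R) hm.measurable.aemeasurable
    (f := fun x => g x * h x) (by rw [hm.map_eq]; exact (by fun_prop : Continuous _).aestronglyMeasurable)
  rw [hm.map_eq] at this
  exact this.symm

lemma integrable_of_continuous {g : Sph d → ℝ} (hg : Continuous g) : Integrable g (unif d) :=
  hg.integrable_of_hasCompactSupport (HasCompactSupport.of_compactSpace g)

/-- An orthonormal basis of `harmonicsLE d k`, with the addition formula on the diagonal. -/
lemma exists_orthonormal_family [NeZero d] (k : ℕ) :
    ∃ (m : ℕ) (φ : Fin m → C(Sph d, ℝ)), m ≤ (k + 1) * (d + k - 1).choose k ∧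
      (∀ j, φ j ∈ harmonicsLE d k) ∧
      (∀ i j, ∫ x, φ i x * φ j x ∂(unif d) = if i = j then 1 else 0) ∧
      (∀ h ∈ harmonicsLE d k, ∃ a : Fin m → ℝ, ∀ x, h x = ∑ j, a j * φ j x) ∧
      ∀ x, ∑ j, φ j x ^ 2 = m := by
  let W := (harmonicsLE d k).map (toL2 d).toLinearMap
  let w := stdOrthonormalBasis ℝ W
  choose φ hφ hφw using fun j => (w j).2
  have hφw : ∀ j, toL2 d (φ j) = w j := hφw
  have hortho : ∀ i j, ∫ x, φ i x * φ j x ∂(unif d) = if i = j then 1 else 0 := by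
    intro i j
    rw [← inner_toL2, hφw, hφw, ← Submodule.coe_inner]
    exact orthonormal_iff_ite.mp w.orthonormal i j
  have hexp : ∀ h ∈ harmonicsLE d k, ∀ x, h x = ∑ j, (∫ y, φ j y * h y ∂(unif d)) * φ j x := by
    intro h hh x
    have h1 := congrArg Subtype.val (w.sum_repr' (⟨toL2 d h, h, hh, rfl⟩ : W))
    have h2 : toL2 d (∑ j, (∫ y, φ j y * h y ∂(unif d)) • φ j) = toL2 d h := by
      refine Eq.trans ?_ h1
      rw [map_sum]
      simp only [map_smul, hφw, ← inner_toL2, Submodule.coe_sum, Submodule.coe_smul,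
        Submodule.coe_inner]
    have h3 := DFunLike.congr_fun (toL2_injective h2) x
    rw [← h3]
    simp
  refine ⟨Module.finrank ℝ W, φ, ?_, hφ, hortho, fun h hh => ⟨_, hexp h hh⟩, ?_⟩
  · exact (Submodule.finrank_map_le _ _).trans (finrank_harmonicsLE_le k)
  -- With `K(x) = ∑ φ_j(x)²`, the kernel section `g` at `x` has `g(x) = ‖g‖² = K(x)`. If `R y = x`,
  -- then `g ∘ R` has the same norm and takes the value `K(x)` at `y`, so Cauchy–Schwarz gives
  -- `K(x)² ≤ K(x) K(y)`.
  have hmono : ∀ x y, ∑ j, φ j x ^ 2 ≤ ∑ j, φ j y ^ 2 := by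
    intro x y
    obtain ⟨R, hR⟩ := exists_sphIsometry_eq y x
    let g : C(Sph d, ℝ) := ∑ j, φ j x • φ j
    have hg : g ∈ harmonicsLE d k :=
      Submodule.sum_mem _ fun j _ => Submodule.smul_mem _ _ (hφ j)
    have hga : ∀ z, g z = ∑ j, φ j x * φ j z := fun z => by simp [g]
    have hgg : ∀ h ∈ harmonicsLE d k, ∀ b : Fin _ → ℝ, (∀ z, h z = ∑ j, b j * φ j z) →
        ∫ z, h z * h z ∂(unif d) = ∑ j, b j ^ 2 := by
      intro h hh b hb
      have h1 : ∀ z, h z * h z = ∑ i, ∑ j, b i * b j * (φ i z * φ j z) := fun z => by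
        rw [hb, Finset.sum_mul_sum]
        exact Finset.sum_congr rfl fun i _ => Finset.sum_congr rfl fun j _ => by ring
      simp_rw [h1]
      rw [integral_finsetSum _ fun i _ => integrable_of_continuous (by fun_prop)]
      refine Finset.sum_congr rfl fun i _ => ?_
      rw [integral_finsetSum _ fun j _ => integrable_of_continuous (by fun_prop)]
      simp_rw [integral_const_mul, hortho]
      simp [pow_two]
    have hh := comp_sphIsometry_mem_harmonicsLE R hg
    have h1 := hexp _ hh y
    have h2 := hgg _ hh _ (hexp _ hh)
    have h3 := hgg g hg _ hga
    have h4 := inner_comp_sphIsometry R g g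
    simp only [ContinuousMap.comp_apply] at h1 h2
    rw [hR, hga] at h1
    rw [h4, h3] at h2
    have h5 := Finset.sum_mul_sq_le_sq_mul_sq Finset.univ
      (fun j => ∫ z, φ j z * g (sphIsometry R z) ∂(unif d)) (fun j => φ j y)
    rw [← h1, ← h2] at h5
    have h6 : ∑ j, φ j x * φ j x = ∑ j, φ j x ^ 2 :=
      Finset.sum_congr rfl fun j _ => (pow_two _).symm
    rw [h6, pow_two] at h5
    have h7 : 0 ≤ ∑ j, φ j x ^ 2 := Finset.sum_nonneg fun j _ => sq_nonneg _
    have h8 : 0 ≤ ∑ j, φ j y ^ 2 := Finset.sum_nonneg fun j _ => sq_nonneg _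
    rcases h7.eq_or_lt with h | h
    · rwa [← h]
    · exact le_of_mul_le_mul_left h5 h
  intro x
  have h1 : ∫ y, ∑ j, φ j y ^ 2 ∂(unif d) = Module.finrank ℝ W := by
    rw [integral_finsetSum _ fun j _ => integrable_of_continuous (by fun_prop)]
    simp_rw [pow_two, hortho]
    simp
  have h2 : ∀ y, ∑ j, φ j y ^ 2 = ∑ j, φ j x ^ 2 := fun y => le_antisymm (hmono y x) (hmono x y)
  simp_rw [h2] at h1
  simpa using h1

end Rotation

/-! ### Growth of `N_{l,d}`, tail sums and the truncation threshold -/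

section Dimension

lemma harmDim_add_two_succ (m l : ℕ) :
    harmDim (m + 2) (l + 1) = (m + l + 1).choose m + (m + l).choose m := by
  have h1 : m + 2 + (l + 1) - 1 = (m + l + 1) + 1 := by omega
  have h2 : m + 2 + (l + 1) - 3 = m + l := by omega
  rw [harmDim, h1, h2, show m + 2 - 1 = m + 1 by omega, Nat.choose_succ_succ,
    Nat.choose_succ_succ (m + l) m]
  simp only [Nat.succ_eq_add_one]
  omega

lemma harmDim_add_two_zero (m : ℕ) : harmDim (m + 2) 0 = 1 := by
  rw [harmDim, show m + 2 + 0 - 1 = m + 1 by omega,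
    Nat.choose_self, Nat.choose_eq_zero_of_lt (by omega)]

lemma one_le_harmDim (m l : ℕ) : 1 ≤ harmDim (m + 2) l := by
  cases l with
  | zero => rw [harmDim_add_two_zero]
  | succ l =>
    rw [harmDim_add_two_succ]
    have := Nat.choose_pos (n := m + l) (k := m) (by omega)
    omega

/-- Both binomials in `N_{l+1} = C(m+l+1,m) + C(m+l,m)` grow by at least `(m+l+1)/(l+1)` over those
of `N_l`: the first exactly, the second by `(m+l)/l`. -/
lemma harmDim_ratio (m l : ℕ) (hl : 1 ≤ l) :
    harmDim (m + 2) l * (m + l + 1) ≤ harmDim (m + 2) (l + 1) * (l + 1) := by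
  obtain ⟨j, rfl⟩ : ∃ j, l = j + 1 := ⟨l - 1, by omega⟩
  rw [harmDim_add_two_succ, harmDim_add_two_succ]
  have h1 := Nat.choose_mul_succ_eq (m + j + 1) m
  have h2 := Nat.choose_mul_succ_eq (m + j) m
  rw [show m + j + 1 + 1 - m = j + 2 by omega] at h1
  rw [show m + j + 1 - m = j + 1 by omega] at h2
  rw [show m + (j + 1) = m + j + 1 by ring]
  have h3 : (m + j).choose m * (m + j + 2) ≤ (m + j + 1).choose m * (j + 2) := by
    have h4 : (m + j).choose m * (m + j + 2) * (j + 1)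
        ≤ (m + j + 1).choose m * (j + 2) * (j + 1) := by
      calc (m + j).choose m * (m + j + 2) * (j + 1)
          ≤ (m + j).choose m * (m + j + 1) * (j + 2) := by
            rw [mul_assoc, mul_assoc]
            exact Nat.mul_le_mul_left _ (by ring_nf; omega)
        _ = _ := by rw [h2]; ring
    exact Nat.le_of_mul_le_mul_right h4 (by omega)
  nlinarith

/-- The terms `l^{3/2} N_{l,d}^{-α/2}` controlling the tail of the harmonic expansion. -/
noncomputable def tailTerm (d : ℕ) (α : ℝ) (l : ℕ) : ℝ :=
  (l : ℝ) ^ (3 / 2 : ℝ) * (harmDim d l : ℝ) ^ (-α / 2)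

lemma tailTerm_nonneg (d : ℕ) (α : ℝ) (l : ℕ) : 0 ≤ tailTerm d α l := by
  unfold tailTerm
  positivity

/-- The convex function `t^s` lies below its chord on `[1, 2]`. -/
lemma one_add_rpow_le {x s : ℝ} (hx : 0 ≤ x) (hx1 : x ≤ 1) (hs : 1 ≤ s) :
    (1 + x) ^ s ≤ 1 + x * 2 ^ s := by
  have h := (convexOn_rpow hs).2 (Set.mem_Ici.mpr zero_le_one)
    (Set.mem_Ici.mpr zero_le_two) (sub_nonneg.mpr hx1) hx (sub_add_cancel 1 x)
  simp only [smul_eq_mul, Real.one_rpow] at h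
  rw [show (1 - x) * 1 + x * 2 = 1 + x by ring] at h
  linarith

variable {m : ℕ} {α : ℝ}

/-- The lower bound on the dimension enters here: `(1+1/l)^{5/α} ≤ 1 + 2^{5/α}/l`, and a large `m`
puts this below the ratio of `harmDim_ratio`. The exponent `5/α` is chosen to become `-5/2` after
raising to the power `-α/2`. -/
lemma harmDim_growth (hα : 0 < α) (hα1 : α ≤ 1) (hm : 10 * α⁻¹ * (2 : ℝ) ^ (5 / α) ≤ m)
    {l : ℕ} (hl : 1 ≤ l) :
    (harmDim (m + 2) l : ℝ) * (1 + 1 / (l : ℝ)) ^ (5 / α) ≤ harmDim (m + 2) (l + 1) := by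
  have hl1 : (1 : ℝ) ≤ l := by exact_mod_cast hl
  have hs : 5 ≤ 5 / α := by rw [le_div_iff₀ hα]; linarith
  have h1 := one_add_rpow_le (x := 1 / l) (s := 5 / α) (by positivity)
    (by rw [div_le_one (by positivity)]; exact hl1) (by linarith)
  have h2 : ((harmDim (m + 2) l * (m + l + 1) : ℕ) : ℝ)
      ≤ (harmDim (m + 2) (l + 1) * (l + 1) : ℕ) := by exact_mod_cast harmDim_ratio m l hl
  push_cast at h2
  set t := (2 : ℝ) ^ (5 / α)
  have ht : 0 < t := by positivity
  have hmt : 10 * t ≤ m := by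
    refine le_trans ?_ hm
    have : 1 ≤ α⁻¹ := (one_le_inv₀ hα).mpr hα1
    nlinarith
  have h3 : 1 + 1 / (l : ℝ) * t ≤ (m + l + 1) / (l + 1) := by
    rw [le_div_iff₀ (by positivity)]
    have h4 : (1 + 1 / (l : ℝ) * t) * (l + 1) = l + 1 + t + t / l := by
      field_simp
      ring
    have h5 : t / l ≤ t := div_le_self ht.le hl1
    rw [h4]
    linarith
  calc (harmDim (m + 2) l : ℝ) * (1 + 1 / (l : ℝ)) ^ (5 / α)
      ≤ harmDim (m + 2) l * ((m + l + 1) / (l + 1)) := by gcongr; linarith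
    _ ≤ harmDim (m + 2) (l + 1) := by
      rw [← mul_div_assoc, div_le_iff₀ (by positivity)]
      exact h2

/-- In other words `l^{5/2} N_l^{-α/2}` is nonincreasing: the gain `(1+1/l)^{-5/2}` from
`harmDim_growth` exactly offsets the growth of `l^{5/2}`. -/
lemma tailTerm_succ_le (hα : 0 < α) (hα1 : α ≤ 1) (hm : 10 * α⁻¹ * (2 : ℝ) ^ (5 / α) ≤ m)
    {l : ℕ} (hl : 1 ≤ l) :
    tailTerm (m + 2) α (l + 1) * (l + 1) ≤ tailTerm (m + 2) α l * l := by
  have hl1 : (1 : ℝ) ≤ l := by exact_mod_cast hl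
  have hH : (0 : ℝ) < harmDim (m + 2) l := by exact_mod_cast one_le_harmDim m l
  set y : ℝ := 1 + 1 / (l : ℝ) with hy
  have hy0 : 0 < y := by positivity
  have hly : (l : ℝ) + 1 = l * y := by rw [hy]; field_simp
  have h1 : (harmDim (m + 2) (l + 1) : ℝ) ^ (-α / 2)
      ≤ (harmDim (m + 2) l : ℝ) ^ (-α / 2) * y ^ (-5 / 2 : ℝ) := by
    have h2 := Real.rpow_le_rpow_of_nonpos (z := -α / 2) (by positivity)
      (harmDim_growth hα hα1 hm hl) (by linarith)
    rw [Real.mul_rpow hH.le (by positivity), ← Real.rpow_mul hy0.le] at h2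
    have h3 : 5 / α * (-α / 2) = -5 / 2 := by field_simp
    rwa [h3] at h2
  have h4 : y ^ (3 / 2 : ℝ) * y ^ (-5 / 2 : ℝ) * y = 1 := by
    rw [← Real.rpow_add hy0, ← Real.rpow_add_one hy0.ne']
    norm_num
  unfold tailTerm
  push_cast
  rw [hly, Real.mul_rpow (by positivity) hy0.le]
  calc (l : ℝ) ^ (3 / 2 : ℝ) * y ^ (3 / 2 : ℝ) * (harmDim (m + 2) (l + 1) : ℝ) ^ (-α / 2) * (l * y)
      ≤ (l : ℝ) ^ (3 / 2 : ℝ) * y ^ (3 / 2 : ℝ) *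
        ((harmDim (m + 2) l : ℝ) ^ (-α / 2) * y ^ (-5 / 2 : ℝ)) * (l * y) := by gcongr
    _ = (l : ℝ) ^ (3 / 2 : ℝ) * (harmDim (m + 2) l : ℝ) ^ (-α / 2) * l *
        (y ^ (3 / 2 : ℝ) * y ^ (-5 / 2 : ℝ) * y) := by ring
    _ = _ := by rw [h4, mul_one]

lemma tailTerm_mul_le_one (hα : 0 < α) (hα1 : α ≤ 1) (hm : 10 * α⁻¹ * (2 : ℝ) ^ (5 / α) ≤ m)
    {l : ℕ} (hl : 1 ≤ l) : tailTerm (m + 2) α l * l ≤ 1 := by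
  induction l, hl using Nat.le_induction with
  | base =>
    have h1 : (1 : ℝ) ≤ harmDim (m + 2) 1 := by exact_mod_cast one_le_harmDim m 1
    have := Real.rpow_le_one_of_one_le_of_nonpos h1 (z := -α / 2) (by linarith)
    simpa [tailTerm] using this
  | succ l hl ih =>
    push_cast
    exact (tailTerm_succ_le hα hα1 hm hl).trans ih

/-- The telescoping step. As `√(ln(l+1)) ≤ √l`, the summand is at most `z = tailTerm l / l`, while
`tailTerm` drops by at least `z l/(l+1) ≥ z/2`. -/
lemma summand_le_tailTerm_sub (hα : 0 < α) (hα1 : α ≤ 1)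
    (hm : 10 * α⁻¹ * (2 : ℝ) ^ (5 / α) ≤ m) {l : ℕ} (hl : 1 ≤ l) :
    √(Real.log ((l : ℝ) + 1)) * (harmDim (m + 2) l : ℝ) ^ (-α / 2)
      ≤ 2 * (tailTerm (m + 2) α l - tailTerm (m + 2) α (l + 1)) := by
  have hl1 : (1 : ℝ) ≤ l := by exact_mod_cast hl
  have hsucc := tailTerm_succ_le hα hα1 hm hl
  have hlog : √(Real.log ((l : ℝ) + 1)) ≤ (l : ℝ) ^ (1 / 2 : ℝ) := by
    rw [← Real.sqrt_eq_rpow]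
    refine Real.sqrt_le_sqrt ?_
    have := Real.log_le_sub_one_of_pos (x := (l : ℝ) + 1) (by positivity)
    linarith
  have h0 : √(Real.log ((l : ℝ) + 1)) * (harmDim (m + 2) l : ℝ) ^ (-α / 2)
      ≤ (l : ℝ) ^ (1 / 2 : ℝ) * (harmDim (m + 2) l : ℝ) ^ (-α / 2) := by gcongr
  have h1 : (l : ℝ) ^ (1 / 2 : ℝ) * (harmDim (m + 2) l : ℝ) ^ (-α / 2) * l
      = tailTerm (m + 2) α l := by
    rw [tailTerm, mul_right_comm, ← Real.rpow_add_one (by positivity)]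
    norm_num
  set z := (l : ℝ) ^ (1 / 2 : ℝ) * (harmDim (m + 2) l : ℝ) ^ (-α / 2)
  have hz : 0 ≤ z := by positivity
  refine h0.trans ?_
  rw [← h1] at hsucc ⊢
  have h2 : tailTerm (m + 2) α (l + 1) ≤ z * l * l / (l + 1) := by
    rw [le_div_iff₀ (by positivity)]
    exact hsucc
  have h3 : z * l * l / (l + 1) ≤ z * (l - 1 / 2) := by
    rw [div_le_iff₀ (by positivity)]
    have : 0 ≤ z * (l - 1) := mul_nonneg hz (by linarith)
    nlinarith
  linarith

/-- The tail sums of the sup norm bounds. -/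
lemma summable_and_tsum_tail_le (hα : 0 < α) (hα1 : α ≤ 1)
    (hm : 10 * α⁻¹ * (2 : ℝ) ^ (5 / α) ≤ m) :
    (Summable fun l : ℕ => √(Real.log ((l : ℝ) + 1)) * (harmDim (m + 2) l : ℝ) ^ (-α / 2)) ∧
    ∀ k : ℕ, ∑' l : ℕ, √(Real.log (((l + (k + 1) : ℕ) : ℝ) + 1)) *
      (harmDim (m + 2) (l + (k + 1)) : ℝ) ^ (-α / 2) ≤ 2 * tailTerm (m + 2) α (k + 1) := by
  set b : ℕ → ℝ := fun l => √(Real.log ((l : ℝ) + 1)) * (harmDim (m + 2) l : ℝ) ^ (-α / 2) with hb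
  have hb0 : ∀ l, 0 ≤ b l := fun l => by simp only [hb]; positivity
  have hpart : ∀ k N : ℕ, ∑ l ∈ Finset.range N, b (l + (k + 1))
      ≤ 2 * tailTerm (m + 2) α (k + 1) := by
    intro k N
    have h1 : ∑ l ∈ Finset.range N, b (l + (k + 1))
        ≤ 2 * (tailTerm (m + 2) α (k + 1) - tailTerm (m + 2) α (N + (k + 1))) := by
      induction N with
      | zero => simp
      | succ N ih =>
        rw [Finset.sum_range_succ]
        have := summand_le_tailTerm_sub hα hα1 hm (l := N + (k + 1)) (by omega)
        rw [show N + (k + 1) + 1 = N + 1 + (k + 1) by ring] at this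
        linarith
    have := tailTerm_nonneg (m + 2) α (N + (k + 1))
    linarith
  constructor
  · rw [← summable_nat_add_iff 1]
    exact summable_of_sum_range_le (fun l => hb0 _) (hpart 0)
  · exact fun k => Real.tsum_le_of_sum_range_le (fun l => hb0 _) (hpart k)

lemma exists_isTruncThreshold (hα : 0 < α) (hα1 : α ≤ 1)
    (hm : 10 * α⁻¹ * (2 : ℝ) ^ (5 / α) ≤ m) {c₁ c₂ ε : ℝ} (hc₁ : 0 < c₁) (hc₂ : 0 < c₂)
    (hε : 0 < ε) : ∃ k, IsTruncThreshold (m + 2) α c₁ c₂ ε k := by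
  obtain ⟨l, hl⟩ := exists_nat_gt (2 * c₁ * c₂ * (2 / ε))
  have hne : {l : ℕ | 2 * c₁ * c₂ * ((l : ℝ) + 1) ^ (3 / 2 : ℝ) *
      (harmDim (m + 2) (l + 1) : ℝ) ^ (-α / 2) ≤ ε / 2}.Nonempty := by
    refine ⟨l, ?_⟩
    have h1 := tailTerm_mul_le_one hα hα1 hm (l := l + 1) (by omega)
    have h2 := tailTerm_nonneg (m + 2) α (l + 1)
    have h3 : 2 * c₁ * c₂ < l * (ε / 2) := by
      have : 2 * c₁ * c₂ = 2 * c₁ * c₂ * (2 / ε) * (ε / 2) := by field_simp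
      rw [this]
      gcongr
    have h4 : 2 * c₁ * c₂ * tailTerm (m + 2) α (l + 1) ≤ ε / 2 := by
      push_cast at h1
      calc 2 * c₁ * c₂ * tailTerm (m + 2) α (l + 1)
          ≤ (l * (ε / 2)) * tailTerm (m + 2) α (l + 1) := by gcongr
        _ ≤ ε / 2 * (tailTerm (m + 2) α (l + 1) * (l + 1)) := by nlinarith
        _ ≤ ε / 2 * 1 := by gcongr
        _ = ε / 2 := mul_one _
    rw [tailTerm] at h4
    push_cast at h4
    rw [← mul_assoc] at h4
    exact h4
  exact ⟨_, Nat.sInf_mem hne, fun _ => Nat.sInf_le⟩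

/-- The dimension of the function class is polynomial in the parameters. -/
lemma finrank_bound_of_isTruncThreshold (hα : 0 < α) (hα1 : α ≤ 1)
    (hm : 10 * α⁻¹ * (2 : ℝ) ^ (5 / α) ≤ m) {c₁ c₂ ε : ℝ} (hc₁ : 0 < c₁) (hc₂ : 0 < c₂)
    (hε : 0 < ε) {k : ℕ} (hk : IsTruncThreshold (m + 2) α c₁ c₂ ε k) :
    (((k + 1) * (m + 2 + k - 1).choose k : ℕ) : ℝ)
      ≤ ((1 + 4 * (c₁ * c₂) * (1 / ε)) ^ (1 / α)) ^ 15 := by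
  set B := 1 + 4 * (c₁ * c₂) * (1 / ε) with hB
  have hB1 : 1 ≤ B := by
    have : 0 ≤ 4 * (c₁ * c₂) * (1 / ε) := by positivity
    linarith
  rcases Nat.eq_zero_or_pos k with rfl | hk0
  · simp only [Nat.choose_zero_right]
    push_cast
    exact one_le_pow₀ (Real.one_le_rpow hB1 (by positivity))
  have hm0 : 1 ≤ m := by
    have : (0 : ℝ) < m := lt_of_lt_of_le (by positivity) hm
    exact_mod_cast this
  have hk1 : (1 : ℝ) ≤ k := by exact_mod_cast hk0
  set H := harmDim (m + 2) k with hHdef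
  have hH1 : (1 : ℝ) ≤ H := by exact_mod_cast one_le_harmDim m k
  have hHpos : (0 : ℝ) < H := by linarith
  have hchoose : (m + k).choose k ≤ H := by
    obtain ⟨l, rfl⟩ : ∃ l, k = l + 1 := ⟨k - 1, by omega⟩
    rw [hHdef, harmDim_add_two_succ, Nat.choose_symm_of_eq_add (show m + (l + 1) = l + 1 + m by ring)]
    exact Nat.le_add_right _ _
  have hk2 : k + 1 ≤ (m + k).choose k := by
    have h1 : (1 + k).choose k ≤ (m + k).choose k := Nat.choose_le_choose _ (by omega)
    rwa [add_comm 1 k, Nat.choose_succ_self_right] at h1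
  -- One factor `k + 1` counts degrees, another comes from `C(m+k+1,k) ≤ (k+1) C(m+k,k)`; each of `k
  -- + 1` and `C(m+k,k)` is at most `N_k`.
  have hD : (k + 1) * (m + 2 + k - 1).choose k ≤ H ^ 3 := by
    have h1 := Nat.choose_mul_succ_eq (m + k) k
    rw [show m + k + 1 - k = m + 1 by omega] at h1
    have h2 : (m + k + 1).choose k ≤ (m + k).choose k * (k + 1) := by
      refine Nat.le_of_mul_le_mul_right (c := m + 1) ?_ (by omega)
      rw [← h1, mul_assoc]
      exact Nat.mul_le_mul_left _ (by ring_nf; omega)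
    rw [show m + 2 + k - 1 = m + k + 1 by omega]
    calc (k + 1) * (m + k + 1).choose k ≤ H * (H * H) :=
          Nat.mul_le_mul (hk2.trans hchoose)
            (h2.trans (Nat.mul_le_mul hchoose (hk2.trans hchoose)))
      _ = H ^ 3 := by ring
  have hHB : (H : ℝ) ≤ (B ^ (1 / α)) ^ 5 := by
    -- By minimality the threshold inequality fails at `k - 1`. Since `k^{5/2} ≤ N_k^{α/2}`,
    -- `tailTerm k ≤ N_k^{-α/5}`, whence `N_k^{α/5} ≤ 4c₁c₂/ε`. The summand `1` in `B` serves the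
    -- case `k = 0`.
    have hmin : ε / 2 < 2 * c₁ * c₂ * tailTerm (m + 2) α k := by
      by_contra! hcon
      have : k ≤ k - 1 := hk.2 (by
        rw [Set.mem_ofPred_eq, Nat.cast_sub hk0, Nat.sub_add_cancel hk0]
        rw [tailTerm, ← mul_assoc] at hcon
        simpa using hcon)
      omega
    have hdec := tailTerm_mul_le_one hα hα1 hm hk0
    have hHα : (0 : ℝ) < (H : ℝ) ^ (α / 5) := by positivity
    have hsplit : (H : ℝ) ^ (-α / 2) = ((H : ℝ) ^ (α / 5)) ^ (-5 / 2 : ℝ) := by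
      rw [← Real.rpow_mul hHpos.le]
      congr 1
      ring
    have hkH : (k : ℝ) ≤ (H : ℝ) ^ (α / 5) := by
      rw [tailTerm, mul_right_comm, ← Real.rpow_add_one (by positivity), hsplit] at hdec
      have h1 : (k : ℝ) ^ (5 / 2 : ℝ) ≤ ((H : ℝ) ^ (α / 5)) ^ (5 / 2 : ℝ) := by
        rw [show (-5 / 2 : ℝ) = -(5 / 2) by norm_num, Real.rpow_neg hHα.le,
          ← div_eq_mul_inv, div_le_one (by positivity)] at hdec
        rwa [show (3 / 2 + 1 : ℝ) = 5 / 2 by norm_num] at hdec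
      exact (Real.rpow_le_rpow_iff (by positivity) hHα.le (by norm_num)).mp h1
    have hlt : (H : ℝ) ^ (α / 5) ≤ B := by
      have h1 : tailTerm (m + 2) α k ≤ ((H : ℝ) ^ (α / 5))⁻¹ := by
        rw [tailTerm, hsplit, ← Real.rpow_neg_one]
        calc (k : ℝ) ^ (3 / 2 : ℝ) * ((H : ℝ) ^ (α / 5)) ^ (-5 / 2 : ℝ)
            ≤ ((H : ℝ) ^ (α / 5)) ^ (3 / 2 : ℝ) * ((H : ℝ) ^ (α / 5)) ^ (-5 / 2 : ℝ) := by gcongr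
          _ = _ := by
            rw [← Real.rpow_add hHα]
            norm_num
      have h2 : ε / 2 < 2 * c₁ * c₂ * ((H : ℝ) ^ (α / 5))⁻¹ :=
        hmin.trans_le (by gcongr)
      rw [← div_eq_mul_inv, lt_div_iff₀ hHα] at h2
      have h3 : (H : ℝ) ^ (α / 5) ≤ 4 * (c₁ * c₂) * (1 / ε) := by
        rw [mul_one_div, le_div_iff₀ hε]
        linarith
      linarith
    calc (H : ℝ) = ((H : ℝ) ^ (α / 5)) ^ (5 / α) := by
          rw [← Real.rpow_mul hHpos.le, show α / 5 * (5 / α) = 1 by field_simp, Real.rpow_one]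
      _ ≤ B ^ (5 / α) := by gcongr
      _ = (B ^ (1 / α)) ^ 5 := by
          rw [← Real.rpow_natCast, ← Real.rpow_mul (by linarith)]
          congr 1
          push_cast
          ring
  calc (((k + 1) * (m + 2 + k - 1).choose k : ℕ) : ℝ) ≤ (H : ℝ) ^ 3 := by exact_mod_cast hD
    _ ≤ ((B ^ (1 / α)) ^ 5) ^ 3 := by gcongr
    _ = (B ^ (1 / α)) ^ 15 := by rw [← pow_mul]

end Dimension

/-! ### Concentration and the deterministic least-squares estimate -/

section Concentration

open scoped NNReal

variable {X : Type*} [MeasurableSpace X]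

/-- Two-sided Hoeffding inequality for a sub-Gaussian function of i.i.d. samples. -/
lemma measureReal_abs_sum_ge_le {ν : Measure X} [IsProbabilityMeasure ν] {Z : X → ℝ} {c : ℝ≥0}
    (hZ : HasSubgaussianMGF Z c ν) (n : ℕ) {s : ℝ} (hs : 0 ≤ s) :
    (Measure.pi fun _ : Fin n => ν).real {ω | s ≤ |∑ i, Z (ω i)|}
      ≤ 2 * Real.exp (-s ^ 2 / (2 * (n * c))) := by
  have key : ∀ {Y : X → ℝ}, HasSubgaussianMGF Y c ν →
      (Measure.pi fun _ : Fin n => ν).real {ω | s ≤ ∑ i, Y (ω i)}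
        ≤ Real.exp (-s ^ 2 / (2 * (n * c))) := by
    intro Y hY
    have hind : iIndepFun (fun (i : Fin n) (ω : Fin n → X) => Y (ω i))
        (Measure.pi fun _ : Fin n => ν) := iIndepFun_pi fun _ => hY.aemeasurable
    have hsub : ∀ i : Fin n, HasSubgaussianMGF (fun ω : Fin n → X => Y (ω i)) c
        (Measure.pi fun _ : Fin n => ν) := fun i => by
      have hmp := measurePreserving_eval (fun _ : Fin n => ν) i
      exact HasSubgaussianMGF.of_map (X := Y) hmp.measurable.aemeasurable (by rwa [hmp.map_eq])
    have := HasSubgaussianMGF.measure_sum_ge_le_of_iIndepFun hind (c := fun _ => c)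
      (s := Finset.univ) (fun i _ => hsub i) hs
    simpa using this
  have hsplit : {ω : Fin n → X | s ≤ |∑ i, Z (ω i)|}
      ⊆ {ω | s ≤ ∑ i, Z (ω i)} ∪ {ω | s ≤ ∑ i, (-Z) (ω i)} := by
    intro ω hω
    have hω' : s ≤ |∑ i, Z (ω i)| := hω
    rcases le_abs'.mp hω' with h | h
    · right
      simp only [Set.mem_ofPred_eq, Pi.neg_apply, Finset.sum_neg_distrib]
      linarith
    · exact Or.inl h
  calc _ ≤ _ := measureReal_mono hsplit
    _ ≤ _ := measureReal_union_le _ _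
    _ ≤ _ := add_le_add (key hZ) (key hZ.neg)
    _ = _ := by ring

lemma hasSubgaussianMGF_of_abs_le {μ : Measure X} [IsProbabilityMeasure μ] {Z : X → ℝ}
    (hZ : Measurable Z) {M : ℝ≥0} (hM : ∀ x, |Z x| ≤ M) :
    HasSubgaussianMGF (fun x => Z x - ∫ y, Z y ∂μ) (M ^ 2) μ := by
  have h := hasSubgaussianMGF_of_mem_Icc (μ := μ) (a := -M) (b := M) hZ.aemeasurable
    (Filter.Eventually.of_forall fun x => abs_le.mp (hM x))
  have hc : (‖(M : ℝ) - -M‖₊ / 2) ^ 2 = M ^ 2 := by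
    congr 1
    apply NNReal.eq
    push_cast
    rw [Real.norm_eq_abs, abs_of_nonneg (by have := M.2; linarith)]
    ring
  rwa [hc] at h

lemma hasSubgaussianMGF_comp_fst {μ : Measure X} [IsProbabilityMeasure μ] {Y : Type*}
    [MeasurableSpace Y] {γ : Measure Y} [IsProbabilityMeasure γ] {Z : X → ℝ} {c : ℝ≥0}
    (hZ : HasSubgaussianMGF Z c μ) : HasSubgaussianMGF (fun z : X × Y => Z z.1) c (μ.prod γ) := by
  have hmp := measurePreserving_fst (μ := μ) (ν := γ)
  exact HasSubgaussianMGF.of_map (X := Z) hmp.measurable.aemeasurable (by rwa [hmp.map_eq])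

/-- For fixed `x` the product is Gaussian with variance `φ(x)² ≤ c`; its moment generating function
is bounded uniformly in `x` and then averaged. -/
lemma hasSubgaussianMGF_mul_gaussian {μ : Measure X} [IsProbabilityMeasure μ] {φ : X → ℝ}
    (hφ : Measurable φ) {c : ℝ≥0} (hc : ∀ x, φ x ^ 2 ≤ c) :
    HasSubgaussianMGF (fun z : X × ℝ => φ z.1 * z.2) c (μ.prod (gaussianReal 0 1)) := by
  have hinner : ∀ t x, ∫ y, Real.exp (t * (φ x * y)) ∂(gaussianReal 0 1)
      = Real.exp (φ x ^ 2 * t ^ 2 / 2) := by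
    intro t x
    have h := congrFun (mgf_fun_id_gaussianReal (μ := 0) (v := 1)) (t * φ x)
    simp only [mgf] at h
    simp_rw [← mul_assoc]
    rw [h]
    congr 1
    simp
    ring
  have hle : ∀ t x, Real.exp (φ x ^ 2 * t ^ 2 / 2) ≤ Real.exp (c * t ^ 2 / 2) := fun t x => by
    gcongr
    exact hc x
  have hint1 : ∀ t, Integrable (fun x => Real.exp (φ x ^ 2 * t ^ 2 / 2)) μ := fun t =>
    Integrable.of_bound (by fun_prop) (Real.exp (c * t ^ 2 / 2))
      (Filter.Eventually.of_forall fun x => by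
        rw [Real.norm_eq_abs, abs_of_pos (Real.exp_pos _)]
        exact hle t x)
  have hint : ∀ t, Integrable (fun z : X × ℝ => Real.exp (t * (φ z.1 * z.2)))
      (μ.prod (gaussianReal 0 1)) := by
    intro t
    rw [integrable_prod_iff (by fun_prop)]
    refine ⟨Filter.Eventually.of_forall fun x => ?_, ?_⟩
    · simp_rw [← mul_assoc]
      exact integrable_exp_mul_gaussianReal _
    · simp_rw [Real.norm_eq_abs, abs_of_pos (Real.exp_pos _), hinner]
      exact hint1 t
  refine ⟨hint, fun t => ?_⟩
  rw [mgf, integral_prod _ (hint t)]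
  simp_rw [hinner]
  calc ∫ x, Real.exp (φ x ^ 2 * t ^ 2 / 2) ∂μ ≤ ∫ _x, Real.exp (c * t ^ 2 / 2) ∂μ :=
        integral_mono (hint1 t) (integrable_const _) (hle t)
    _ = _ := by simp

/-- On samples where the empirical Gram matrix is close to the identity and the noise is nearly
uncorrelated with the basis functions, empirical risk minimization is uniformly accurate. -/
lemma abs_sum_le_of_empirical {n m : ℕ} (hm : 0 < m) {ε : ℝ} (hε : 0 < ε) (hn : 0 < n)
    (v : Fin n → Fin m → ℝ) (e : Fin n → ℝ)
    (hG : ∀ j l, |∑ i, (v i j * v i l - if j = l then 1 else 0)| ≤ n / (2 * m))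
    (hu : ∀ j, |∑ i, v i j * e i| ≤ n * ε / (8 * m)) (a : Fin m → ℝ)
    (ha : ∑ i, (∑ j, a j * v i j) ^ 2 ≤ 2 * ∑ i, (∑ j, a j * v i j) * e i)
    {w : Fin m → ℝ} (hw : ∑ j, w j ^ 2 = m) : |∑ j, a j * w j| ≤ ε / 2 := by
  have hm' : (0 : ℝ) < m := by exact_mod_cast hm
  have hn' : (0 : ℝ) < n := by exact_mod_cast hn
  set A := ∑ j, |a j| with hA
  set S := ∑ j, a j ^ 2 with hS
  have hA0 : 0 ≤ A := Finset.sum_nonneg fun j _ => abs_nonneg _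
  have hAS : A ^ 2 ≤ m * S := by
    have := sq_sum_le_card_mul_sum_sq (s := Finset.univ) (f := fun j => |a j|)
    simpa [sq_abs] using this
  -- The empirical quadratic form is `n ‖a‖²` plus a perturbation by the Gram error.
  have h1 : ∑ i, (∑ j, a j * v i j) ^ 2
      = n * S + ∑ j, ∑ l, a j * a l * ∑ i, (v i j * v i l - if j = l then 1 else 0) := by
    have h2 : ∀ j l, a j * a l * ∑ i, (v i j * v i l - if j = l then 1 else 0)
        = ∑ i, a j * a l * (v i j * v i l) - if j = l then n * (a j * a l) else 0 := by
      intro j l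
      rw [Finset.sum_sub_distrib, mul_sub, Finset.mul_sum]
      congr 1
      split_ifs
      · simp
        ring
      · simp
    simp_rw [h2, Finset.sum_sub_distrib]
    have h3 : ∑ j, ∑ l, (if j = l then n * (a j * a l) else 0) = n * S := by
      simp [hS, Finset.mul_sum, pow_two]
    rw [h3, add_sub_cancel]
    simp_rw [pow_two, Finset.sum_mul_sum]
    rw [Finset.sum_comm]
    refine Finset.sum_congr rfl fun j _ => ?_
    rw [Finset.sum_comm]
    exact Finset.sum_congr rfl fun l _ => Finset.sum_congr rfl fun i _ => by ring
  have h4 : |∑ j, ∑ l, a j * a l * ∑ i, (v i j * v i l - if j = l then 1 else 0)|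
      ≤ A ^ 2 * (n / (2 * m)) := by
    calc _ ≤ ∑ j, ∑ l, |a j| * |a l| * (n / (2 * m)) := by
          refine (Finset.abs_sum_le_sum_abs _ _).trans (Finset.sum_le_sum fun j _ => ?_)
          refine (Finset.abs_sum_le_sum_abs _ _).trans (Finset.sum_le_sum fun l _ => ?_)
          rw [abs_mul, abs_mul]
          exact mul_le_mul_of_nonneg_left (hG j l) (by positivity)
      _ = _ := by
          simp_rw [← Finset.sum_mul]
          rw [← Finset.sum_mul_sum, pow_two]
  have h5 : ∑ i, (∑ j, a j * v i j) * e i = ∑ j, a j * ∑ i, v i j * e i := by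
    simp_rw [Finset.sum_mul, Finset.mul_sum]
    rw [Finset.sum_comm]
    exact Finset.sum_congr rfl fun j _ => Finset.sum_congr rfl fun i _ => by ring
  have h6 : ∑ j, a j * ∑ i, v i j * e i ≤ A * (n * ε / (8 * m)) := by
    rw [hA, Finset.sum_mul]
    refine Finset.sum_le_sum fun j _ => (le_abs_self _).trans ?_
    rw [abs_mul]
    exact mul_le_mul_of_nonneg_left (hu j) (abs_nonneg _)
  rw [h1, h5] at ha
  have h7 : n * S - A ^ 2 * (n / (2 * m)) ≤ 2 * (A * (n * ε / (8 * m))) := by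
    have := neg_le_of_abs_le h4
    linarith
  -- Entrywise Gram error `n/(2m)` and `‖a‖₁² ≤ m ‖a‖²` keep the perturbation below half of the main
  -- term.
  have h8 : A ^ 2 * (n / (2 * m)) ≤ n * S / 2 := by
    calc A ^ 2 * (n / (2 * m)) ≤ m * S * (n / (2 * m)) := by gcongr
      _ = n * S / 2 := by field_simp
  have h9 : m * S ≤ A * (ε / 2) := by
    have h10 : n * S / 2 ≤ n * (A * ε) / (4 * m) := by
      calc n * S / 2 ≤ 2 * (A * (n * ε / (8 * m))) := by linarith
        _ = n * (A * ε) / (4 * m) := by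
          field_simp
          ring
    rw [div_le_div_iff₀ (by norm_num) (by positivity)] at h10
    have h11 : n * (m * S) ≤ n * (A * (ε / 2)) := by linarith
    exact le_of_mul_le_mul_left h11 hn'
  -- Combining `A² ≤ m S` with `m S ≤ A ε/2` bounds `A`, which then bounds `m S` by `(ε/2)²`;
  -- Cauchy–Schwarz with `∑ w_j² = m` finishes.
  have hAε : A ≤ ε / 2 := by
    rcases hA0.eq_or_lt with h | h
    · rw [← h]
      positivity
    · have : A * A ≤ A * (ε / 2) := by linarith [pow_two A]
      exact le_of_mul_le_mul_left this h
  have hcs := Finset.sum_mul_sq_le_sq_mul_sq Finset.univ a w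
  rw [hw] at hcs
  refine abs_le_of_sq_le_sq ?_ (by positivity)
  calc (∑ j, a j * w j) ^ 2 ≤ S * m := hcs
    _ ≤ A * (ε / 2) := by linarith
    _ ≤ (ε / 2) ^ 2 := by
      rw [pow_two]
      gcongr

/-- With high probability, empirical risk minimization over a finite-dimensional space of functions
with an orthonormal basis of constant diagonal kernel is uniformly accurate. -/
lemma exists_good_event (μ : Measure X) [IsProbabilityMeasure μ] {m n : ℕ} (hm : 0 < m)
    {φ : Fin m → X → ℝ} (hφ : ∀ j, Measurable (φ j))
    (hortho : ∀ i j, ∫ x, φ i x * φ j x ∂μ = if i = j then 1 else 0)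
    (hdiag : ∀ x, ∑ j, φ j x ^ 2 = m) {r : X → ℝ} (hr : Measurable r) {ε δ : ℝ} (hε : 0 < ε)
    (hδ : 0 < δ) (hδ1 : δ ≤ 1) (hrε : ∀ x, |r x| ≤ ε / 2) (hrφ : ∀ j, ∫ x, r x * φ j x ∂μ = 0)
    (hn : 512 * (m : ℝ) ^ 4 * (1 + 1 / ε) ^ 2 * (Real.log (1 / δ) + 12 * (m : ℝ) ^ 2) ≤ n) :
    ∃ E : Set (Fin n → X × ℝ), MeasurableSet E ∧
      ENNReal.ofReal (1 - δ) ≤ (Measure.pi fun _ => μ.prod (gaussianReal 0 1)) E ∧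
      ∀ ω ∈ E, ∀ a : Fin m → ℝ,
        ∑ i, (∑ j, a j * φ j (ω i).1) ^ 2
          ≤ 2 * ∑ i, (∑ j, a j * φ j (ω i).1) * (r (ω i).1 + (ω i).2) →
        ∀ x, |∑ j, a j * φ j x| ≤ ε / 2 := by
  have hm1 : (1 : ℝ) ≤ m := by exact_mod_cast hm
  have hlog : 0 ≤ Real.log (1 / δ) := Real.log_nonneg (by rwa [le_div_iff₀ hδ, one_mul])
  -- Each bad event will have probability at most `2e^{-K}`, and there are `m² + 2m ≤ 3m²` of them.
  -- The term `12m²` absorbs this count, since `12m² e^{-12m²} ≤ 1`.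
  set K := Real.log (1 / δ) + 12 * (m : ℝ) ^ 2 with hK
  have hK12 : 12 ≤ K := by nlinarith
  have hn0 : (0 : ℝ) < n := lt_of_lt_of_le (by positivity) hn
  have hφsq : ∀ j x, φ j x ^ 2 ≤ m := fun j x => by
    rw [← hdiag x]
    exact Finset.single_le_sum (f := fun j => φ j x ^ 2) (fun j _ => sq_nonneg _)
      (Finset.mem_univ j)
  have hφabs : ∀ j x, |φ j x| ≤ √m := fun j x => Real.abs_le_sqrt (hφsq j x)
  set ν := μ.prod (gaussianReal 0 1)
  have hsubG : ∀ j l, HasSubgaussianMGF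
      (fun z : X × ℝ => φ j z.1 * φ l z.1 - if j = l then 1 else 0) ((m : ℝ≥0) ^ 2) ν := by
    intro j l
    have := hasSubgaussianMGF_of_abs_le (μ := μ) (M := m) ((hφ j).mul (hφ l)) (fun x => by
      rw [Pi.mul_apply, abs_mul, NNReal.coe_natCast, ← Real.mul_self_sqrt (Nat.cast_nonneg m)]
      exact mul_le_mul (hφabs j x) (hφabs l x) (abs_nonneg _) (Real.sqrt_nonneg _))
    simp only [Pi.mul_apply, hortho] at this
    exact hasSubgaussianMGF_comp_fst this
  have hsubr : ∀ j, HasSubgaussianMGF (fun z : X × ℝ => r z.1 * φ j z.1)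
      ((ε / 2 * √m).toNNReal ^ 2) ν := by
    intro j
    have := hasSubgaussianMGF_of_abs_le (μ := μ) (M := (ε / 2 * √m).toNNReal)
      (hr.mul (hφ j)) (fun x => by
        rw [Pi.mul_apply, abs_mul, Real.coe_toNNReal _ (by positivity)]
        exact mul_le_mul (hrε x) (hφabs j x) (abs_nonneg _) (by positivity))
    simp only [Pi.mul_apply, hrφ, sub_zero] at this
    exact hasSubgaussianMGF_comp_fst this
  have hsubξ : ∀ j, HasSubgaussianMGF (fun z : X × ℝ => φ j z.1 * z.2) (m : ℝ≥0) ν :=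
    fun j => hasSubgaussianMGF_mul_gaussian (hφ j) fun x => by simpa using hφsq j x
  set ℙn := Measure.pi fun _ : Fin n => ν
  set BG : Fin m × Fin m → Set (Fin n → X × ℝ) := fun p =>
    {ω | n / (2 * m) ≤ |∑ i, (φ p.1 (ω i).1 * φ p.2 (ω i).1 - if p.1 = p.2 then 1 else 0)|}
  -- The allowance `nε/(8m)` of the deterministic estimate is split equally between residual and
  -- noise.
  set Br : Fin m → Set (Fin n → X × ℝ) := fun j =>
    {ω | n * ε / (16 * m) ≤ |∑ i, r (ω i).1 * φ j (ω i).1|}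
  set Bξ : Fin m → Set (Fin n → X × ℝ) := fun j =>
    {ω | n * ε / (16 * m) ≤ |∑ i, φ j (ω i).1 * (ω i).2|}
  set η := 2 * Real.exp (-K) with hη
  have hnK : 512 * (m : ℝ) ^ 4 * K ≤ n := by
    refine le_trans ?_ hn
    have : (1 : ℝ) ≤ (1 + 1 / ε) ^ 2 := one_le_pow₀ (by have : 0 < 1 / ε := by positivity
                                                        linarith)
    calc 512 * (m : ℝ) ^ 4 * K = 512 * (m : ℝ) ^ 4 * 1 * K := by ring
      _ ≤ _ := by gcongr
  have hm34 : (m : ℝ) ^ 3 ≤ m ^ 4 := pow_le_pow_right₀ hm1 (by norm_num)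
  have hBG : ∀ p, ℙn.real (BG p) ≤ η := by
    intro p
    refine (measureReal_abs_sum_ge_le (hsubG p.1 p.2) n (by positivity)).trans ?_
    rw [hη]
    gcongr
    rw [neg_div, neg_le_neg_iff]
    push_cast
    have : (n / (2 * m) : ℝ) ^ 2 / (2 * (n * m ^ 2)) = n / (8 * m ^ 4) := by
      field_simp
      ring
    rw [this, le_div_iff₀ (by positivity)]
    have : 0 ≤ (m : ℝ) ^ 4 * K := by positivity
    linarith
  have hBr : ∀ j, ℙn.real (Br j) ≤ η := by
    intro j
    refine (measureReal_abs_sum_ge_le (hsubr j) n (by positivity)).trans ?_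
    rw [hη]
    gcongr
    rw [neg_div, neg_le_neg_iff]
    push_cast
    rw [Real.coe_toNNReal _ (by positivity), mul_pow, Real.sq_sqrt (Nat.cast_nonneg m)]
    have : (n * ε / (16 * m) : ℝ) ^ 2 / (2 * (n * ((ε / 2) ^ 2 * m))) = n / (128 * m ^ 3) := by
      field_simp
      ring
    rw [this, le_div_iff₀ (by positivity)]
    have h1 : (m : ℝ) ^ 3 * K ≤ m ^ 4 * K := by gcongr
    have : 0 ≤ (m : ℝ) ^ 4 * K := by positivity
    linarith
  have hBξ : ∀ j, ℙn.real (Bξ j) ≤ η := by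
    intro j
    refine (measureReal_abs_sum_ge_le (hsubξ j) n (by positivity)).trans ?_
    rw [hη]
    gcongr
    rw [neg_div, neg_le_neg_iff]
    push_cast
    have : (n * ε / (16 * m) : ℝ) ^ 2 / (2 * (n * m)) = n * ε ^ 2 / (512 * m ^ 3) := by
      field_simp
      ring
    rw [this, le_div_iff₀ (by positivity)]
    -- Unlike the residual, which is itself of size `ε`, the noise has fixed scale, so its event
    -- costs the factor `1/ε²` supplied by `(1 + 1/ε)²`.
    have h1 : 1 ≤ ((1 + 1 / ε) * ε) ^ 2 := one_le_pow₀ (by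
      rw [add_mul, one_div_mul_cancel hε.ne']
      linarith)
    calc K * (512 * (m : ℝ) ^ 3) ≤ K * (512 * m ^ 4) := by gcongr
      _ = K * (512 * m ^ 4) * 1 := by ring
      _ ≤ K * (512 * m ^ 4) * ((1 + 1 / ε) * ε) ^ 2 := by gcongr
      _ = (512 * (m : ℝ) ^ 4 * (1 + 1 / ε) ^ 2 * K) * ε ^ 2 := by ring
      _ ≤ n * ε ^ 2 := by gcongr
  set B := (⋃ p, BG p) ∪ ((⋃ j, Br j) ∪ ⋃ j, Bξ j) with hB
  have hBm : MeasurableSet B := by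
    refine .union (.iUnion fun p => ?_) (.union (.iUnion fun j => ?_) (.iUnion fun j => ?_))
    all_goals exact measurableSet_le measurable_const (by fun_prop)
  have hBδ : ℙn.real B ≤ δ := by
    have h1 : ℙn.real (⋃ p, BG p) ≤ m ^ 2 * η := by
      refine (measureReal_iUnion_fintype_le _).trans ((Finset.sum_le_sum fun p _ => hBG p).trans ?_)
      simp [pow_two]
    have h2 : ℙn.real (⋃ j, Br j) ≤ m * η := by
      refine (measureReal_iUnion_fintype_le _).trans ((Finset.sum_le_sum fun p _ => hBr p).trans ?_)
      simp
    have h3 : ℙn.real (⋃ j, Bξ j) ≤ m * η := by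
      refine (measureReal_iUnion_fintype_le _).trans ((Finset.sum_le_sum fun p _ => hBξ p).trans ?_)
      simp
    have h4 : ℙn.real B ≤ m ^ 2 * η + (m * η + m * η) :=
      (measureReal_union_le _ _).trans (add_le_add h1
        ((measureReal_union_le _ _).trans (add_le_add h2 h3)))
    have hη2 : η = 2 * (δ * Real.exp (-(12 * (m : ℝ) ^ 2))) := by
      rw [hη, hK, neg_add, Real.exp_add, one_div, Real.log_inv, neg_neg, Real.exp_log hδ]
    have h5 : 12 * (m : ℝ) ^ 2 * Real.exp (-(12 * (m : ℝ) ^ 2)) ≤ 1 := by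
      rw [Real.exp_neg, ← div_eq_mul_inv, div_le_one (Real.exp_pos _)]
      have := Real.add_one_le_exp (12 * (m : ℝ) ^ 2)
      linarith
    have hη0 : 0 ≤ η := by positivity
    calc ℙn.real B ≤ m ^ 2 * η + (m * η + m * η) := h4
      _ ≤ 3 * m ^ 2 * η := by
        have : (m : ℝ) * η ≤ m ^ 2 * η := by
          gcongr
          exact le_self_pow₀ hm1 (by norm_num)
        linarith
      _ = δ * (12 * (m : ℝ) ^ 2 * Real.exp (-(12 * (m : ℝ) ^ 2))) / 2 := by rw [hη2]; ring
      _ ≤ δ * 1 / 2 := by gcongr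
      _ ≤ δ := by linarith
  refine ⟨Bᶜ, hBm.compl, ?_, ?_⟩
  · rw [← ofReal_measureReal, probReal_compl_eq_one_sub hBm]
    exact ENNReal.ofReal_le_ofReal (by linarith)
  · intro ω hω a ha x
    simp only [hB, Set.mem_compl_iff, Set.mem_union, Set.mem_iUnion, not_or, not_exists, BG, Br, Bξ,
      Set.mem_ofPred_eq, not_le] at hω
    obtain ⟨hωG, hωr, hωξ⟩ := hω
    refine abs_sum_le_of_empirical hm hε (by exact_mod_cast hn0) (fun i j => φ j (ω i).1)
      (fun i => r (ω i).1 + (ω i).2) (fun j l => (hωG (j, l)).le) (fun j => ?_) a ha (hdiag x)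
    have h1 : ∑ i, φ j (ω i).1 * (r (ω i).1 + (ω i).2)
        = ∑ i, r (ω i).1 * φ j (ω i).1 + ∑ i, φ j (ω i).1 * (ω i).2 := by
      rw [← Finset.sum_add_distrib]
      exact Finset.sum_congr rfl fun i _ => by ring
    rw [h1]
    refine (abs_add_le _ _).trans ((add_le_add (hωr j).le (hωξ j).le).trans (le_of_eq ?_))
    field_simp
    ring

end Concentration

/-! ### Sample complexity and assembly -/

section Main

/-- The sample complexity polynomial. -/
noncomputable def sampleComplexityPoly : MvPolynomial (Fin 4) ℕ :=
  6144 * (1 + 4 * MvPolynomial.X 0 * MvPolynomial.X 2) ^ 90 * (1 + MvPolynomial.X 2) ^ 2 *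
    (1 + MvPolynomial.X 3)

lemma aeval_sampleComplexityPoly (c d e L : ℝ) :
    MvPolynomial.aeval ![c, d, e, L] sampleComplexityPoly
      = 6144 * (1 + 4 * c * e) ^ 90 * (1 + e) ^ 2 * (1 + L) := by
  simp [sampleComplexityPoly]

/-- The requirement is of order `M^6` and `M ≤ B^{15/α}`, whence the exponent `90 = 15 · 6`; the
constant is `6144 = 512 · 12`. The remaining factor `T ≥ 1` only grows under the power `1/α ≥ 1`. -/
lemma sampleComplexity_bound {α c e L M n : ℝ} (hα : 0 < α) (hα1 : α ≤ 1) (hc : 0 ≤ c) (he : 0 ≤ e)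
    (hL : 0 ≤ L) (hM1 : 1 ≤ M) (hM : M ≤ ((1 + 4 * c * e) ^ (1 / α)) ^ 15)
    (hn : (6144 * (1 + 4 * c * e) ^ 90 * (1 + e) ^ 2 * (1 + L)) ^ (1 / α) ≤ n) :
    512 * M ^ 4 * (1 + e) ^ 2 * (L + 12 * M ^ 2) ≤ n := by
  refine le_trans ?_ hn
  have h1α : 1 ≤ 1 / α := by rwa [le_div_iff₀ hα, one_mul]
  set B := 1 + 4 * c * e with hB
  have hB1 : 1 ≤ B := by
    have : 0 ≤ 4 * c * e := by positivity
    linarith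
  set T := 6144 * (1 + e) ^ 2 * (1 + L) with hT
  have hT1 : 1 ≤ T := by
    have h1 : (1 : ℝ) ≤ (1 + e) ^ 2 := one_le_pow₀ (by linarith)
    have h2 : (1 : ℝ) ≤ 6144 * (1 + e) ^ 2 := by linarith
    exact one_le_mul_of_one_le_of_one_le h2 (by linarith)
  have hsplit : (6144 * B ^ 90 * (1 + e) ^ 2 * (1 + L)) ^ (1 / α)
      = T ^ (1 / α) * (B ^ (1 / α)) ^ 90 := by
    rw [show 6144 * B ^ 90 * (1 + e) ^ 2 * (1 + L) = T * B ^ 90 by rw [hT]; ring,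
      Real.mul_rpow (by linarith) (by positivity)]
    congr 1
    rw [← Real.rpow_natCast, ← Real.rpow_natCast, ← Real.rpow_mul (by linarith),
      ← Real.rpow_mul (by linarith), mul_comm]
  have hM6 : M ^ 6 ≤ (B ^ (1 / α)) ^ 90 := by
    calc M ^ 6 ≤ ((B ^ (1 / α)) ^ 15) ^ 6 := by gcongr
      _ = _ := by rw [← pow_mul]
  have hTα : T ≤ T ^ (1 / α) := by
    simpa using Real.rpow_le_rpow_of_exponent_le hT1 h1α
  rw [hsplit]
  calc 512 * M ^ 4 * (1 + e) ^ 2 * (L + 12 * M ^ 2)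
      ≤ 512 * M ^ 4 * (1 + e) ^ 2 * (12 * (1 + L) * M ^ 2) := by
        gcongr
        have h1 : (1 : ℝ) ≤ M ^ 2 := one_le_pow₀ hM1
        have h2 : 0 ≤ L * (M ^ 2 - 1) := mul_nonneg hL (by linarith)
        have h3 : 0 ≤ L * M ^ 2 := by positivity
        linarith
    _ = T * M ^ 6 := by rw [hT]; ring
    _ ≤ T ^ (1 / α) * (B ^ (1 / α)) ^ 90 := by gcongr

lemma one_mem_harmonicsLE {d : ℕ} [NeZero d] (k : ℕ) : (1 : C(Sph d, ℝ)) ∈ harmonicsLE d k := by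
  refine harmonicsLE_mono (Nat.zero_le k) ?_
  have := sphRestrict_mem_harmonicsLE (d := d) 0 (MvPolynomial.isHomogeneous_one (Fin d) ℝ)
  rwa [map_one] at this

lemma ae_pi_forall {X : Type*} [MeasurableSpace X] {ν : Measure X} [IsProbabilityMeasure ν]
    {p : X → Prop} (h : ∀ᵐ z ∂ν, p z) (n : ℕ) :
    ∀ᵐ ω ∂(Measure.pi fun _ : Fin n => ν), ∀ i, p (ω i) :=
  ae_all_iff.mpr fun i => (Measure.quasiMeasurePreserving_eval (fun _ : Fin n => ν) i).ae h

/-- The error guarantee of empirical risk minimization at the truncation threshold. -/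
lemma exists_accuracy_event {m : ℕ} {α c₁ c₂ : ℝ} (hα : 0 < α) (hα1 : α ≤ 1) (hc₁ : 0 < c₁)
    (hc₂ : 0 < c₂) (hm : 10 * α⁻¹ * (2 : ℝ) ^ (5 / α) ≤ m) {f : Sph (m + 2) → ℝ}
    (hf : MemLp f 2 (unif (m + 2))) (hdecay : DecayCond (m + 2) α c₁ (hf.toLp f))
    (hspiky : NotSpikyCond (m + 2) c₂ (hf.toLp f)) {ε δ : ℝ} (hε : 0 < ε) (hδ : 0 < δ)
    (hδ1 : δ ≤ 1) {n : ℕ}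
    (hn : (6144 * (1 + 4 * (c₁ * c₂) * (1 / ε)) ^ 90 * (1 + 1 / ε) ^ 2 *
      (1 + Real.log (1 / δ))) ^ (1 / α) ≤ (n : ℝ)) :
    ∃ E : Set (Fin n → Sph (m + 2) × ℝ), MeasurableSet E ∧
      ENNReal.ofReal (1 - δ) ≤ sampleLaw (m + 2) n E ∧
      ∀ ω ∈ E, ∀ g : C(Sph (m + 2), ℝ), IsOutput (m + 2) α c₁ c₂ ε (dataset f ω) g →
        eLpNorm (fun x => f x - g x) ∞ (unif (m + 2)) ≤ ENNReal.ofReal ε ∧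
        (Continuous f → ∀ x, |f x - g x| ≤ ε) := by
  obtain ⟨k, hk⟩ := exists_isTruncThreshold hα hα1 hm hc₁ hc₂ hε
  obtain ⟨hsum, htail⟩ := summable_and_tsum_tail_le hα hα1 hm
  set b : ℕ → ℝ := fun l => c₁ * c₂ *
    (√(Real.log ((l : ℝ) + 1)) * (harmDim (m + 2) l : ℝ) ^ (-α / 2)) with hb
  have hbound : ∀ l, eLpNorm (harmProj (m + 2) l (hf.toLp f)) ∞ (unif (m + 2))
      ≤ ENNReal.ofReal (b l) := fun l => by
    refine (hspiky l).trans (ENNReal.ofReal_le_ofReal ?_)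
    calc c₂ * √(Real.log ((l : ℝ) + 1)) * ‖harmProj (m + 2) l (hf.toLp f)‖
        ≤ c₂ * √(Real.log ((l : ℝ) + 1)) * (c₁ * (harmDim (m + 2) l : ℝ) ^ (-α / 2)) := by
          gcongr
          exact hdecay l
      _ = b l := by rw [hb]; ring
  obtain ⟨F, G, hF, hGmem, hGproj, hortho, hFG⟩ := exists_continuous_truncation (hf.toLp f)
    (hsum.mul_left (c₁ * c₂)) (fun l => by positivity) hbound k
  have hFGε : ∀ x, |F x - G x| ≤ ε / 2 := fun x => by
    refine (hFG x).trans ?_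
    simp only [tsum_mul_left]
    calc _ ≤ c₁ * c₂ * (2 * tailTerm (m + 2) α (k + 1)) := by
          gcongr
          exact htail k
      _ = 2 * c₁ * c₂ * ((k : ℝ) + 1) ^ (3 / 2 : ℝ) *
          (harmDim (m + 2) (k + 1) : ℝ) ^ (-α / 2) := by
          rw [tailTerm]
          push_cast
          ring
      _ ≤ ε / 2 := hk.1
  have hfF : f =ᵐ[unif (m + 2)] F := by
    have h1 := hf.coeFn_toLp
    rw [← hF] at h1
    exact h1.symm.trans (ae_toL2 F)
  -- The truncation is an admissible competitor because `N_l ≥ 1` makes the decay bound at most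
  -- `c₁`.
  have hGclass : G ∈ funClass (m + 2) c₁ k := by
    refine ⟨hGmem, fun l hl => ?_⟩
    rw [hGproj l hl]
    refine (hdecay l).trans ?_
    have h1 : (1 : ℝ) ≤ harmDim (m + 2) l := by exact_mod_cast one_le_harmDim m l
    have h2 := Real.rpow_le_one_of_one_le_of_nonpos h1 (z := -α / 2) (by linarith)
    nlinarith
  obtain ⟨D, φ, hD, hφmem, hφortho, hφspan, hφdiag⟩ :=
    exists_orthonormal_family (d := m + 2) k
  have hDpos : 0 < D := by
    rcases Nat.eq_zero_or_pos D with rfl | h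
    · obtain ⟨a, ha⟩ := hφspan 1 (one_mem_harmonicsLE k)
      have := ha ⟨EuclideanSpace.single 0 1, by simp⟩
      simp at this
    · exact h
  have hDM : (D : ℝ) ≤ ((1 + 4 * (c₁ * c₂) * (1 / ε)) ^ (1 / α)) ^ 15 :=
    le_trans (by exact_mod_cast hD) (finrank_bound_of_isTruncThreshold hα hα1 hm hc₁ hc₂ hε hk)
  have hlog : 0 ≤ Real.log (1 / δ) := Real.log_nonneg (by rwa [le_div_iff₀ hδ, one_mul])
  have hn' := sampleComplexity_bound hα hα1 (by positivity : 0 ≤ c₁ * c₂)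
    (by positivity : 0 ≤ 1 / ε) hlog (by exact_mod_cast hDpos) hDM hn
  obtain ⟨E, hEm, hEμ, hE⟩ := exists_good_event (unif (m + 2)) hDpos (φ := fun j => φ j)
    (fun j => (φ j).continuous.measurable) hφortho hφdiag (r := fun x => F x - G x)
    (F.continuous.sub G.continuous).measurable hε hδ hδ1 hFGε
    (fun j => hortho _ (hφmem j)) hn'
  have hae : ∀ᵐ ω ∂(sampleLaw (m + 2) n), ∀ i, f (ω i).1 = F (ω i).1 := by
    refine ae_pi_forall (p := fun z : Sph (m + 2) × ℝ => f z.1 = F z.1) ?_ n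
    exact Measure.quasiMeasurePreserving_fst.ae hfF
  -- Samples hitting the null set where `f ≠ F` are discarded; a measurable hull is used because
  -- that set of samples need not be measurable.
  set N := toMeasurable (sampleLaw (m + 2) n) {ω | ¬ ∀ i, f (ω i).1 = F (ω i).1} with hN
  have hN0 : sampleLaw (m + 2) n N = 0 := by
    rw [hN, measure_toMeasurable]
    exact hae
  refine ⟨E \ N, hEm.diff (measurableSet_toMeasurable _ _), ?_, ?_⟩
  · rw [measure_sdiff_null hN0]
    exact hEμ
  · rintro ω ⟨hωE, hωN⟩ g ⟨k', hk', hg, hmin⟩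
    obtain rfl : k' = k := hk'.unique hk
    have hωf : ∀ i, f (ω i).1 = F (ω i).1 := by
      by_contra hcon
      exact hωN (subset_toMeasurable _ _ hcon)
    obtain ⟨a, ha⟩ := hφspan (g - G) (Submodule.sub_mem _ hg.1 hGmem)
    have hgG : ∀ x, |g x - G x| ≤ ε / 2 := by
      intro x
      have := hE ω hωE a ?_ x
      · rw [← ha] at this
        exact this
      -- With `y_i = F(x_i) + ξ_i`, minimality against `G` rearranges to `∑ (g-G)² ≤ 2 ∑
      -- (g-G)(F-G+ξ)`, the hypothesis of the deterministic estimate.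
      have hle := hmin G hGclass
      simp only [dataset, hωf] at hle
      simp only [← ha, ContinuousMap.sub_apply]
      rw [← sub_nonneg, ← Finset.sum_sub_distrib] at hle
      rw [← sub_nonneg, Finset.mul_sum, ← Finset.sum_sub_distrib]
      refine hle.trans (le_of_eq (Finset.sum_congr rfl fun i _ => ?_))
      ring
    have hFg : ∀ x, |F x - g x| ≤ ε := fun x => by
      calc |F x - g x| = |(F x - G x) - (g x - G x)| := by ring_nf
        _ ≤ |F x - G x| + |g x - G x| := abs_sub _ _
        _ ≤ ε / 2 + ε / 2 := add_le_add (hFGε x) (hgG x)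
        _ = ε := by ring
    constructor
    · refine eLpNormEssSup_le_of_ae_bound ?_ |> fun h => by rwa [eLpNorm_exponent_top]
      filter_upwards [hfF] with x hx
      rw [hx]
      exact hFg x
    · intro hfc x
      have : f = F := (Continuous.ae_eq_iff_eq (unif (m + 2)) hfc F.continuous).mp hfF
      rw [this]
      exact hFg x

end Main
theorem theorem1 :
    ∃ P : MvPolynomial (Fin 4) ℕ,
      ∀ (d : ℕ) (α c₁ c₂ : ℝ), 0 < α → α ≤ 1 → 0 < c₁ → 0 < c₂ →
        10 * α⁻¹ * (2 : ℝ) ^ (5 / α) + 2 ≤ (d : ℝ) →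
      ∀ (f : Sph d → ℝ) (hf : MemLp f 2 (unif d)),
        DecayCond d α c₁ (hf.toLp f) → NotSpikyCond d c₂ (hf.toLp f) →
      ∀ ε δ : ℝ, 0 < ε → 0 < δ →
      ∀ n : ℕ,
        (MvPolynomial.aeval ![c₁ * c₂, (d : ℝ), 1 / ε, Real.log (1 / δ)] P : ℝ) ^ (1 / α) ≤ (n : ℝ) →
        (∀ D : Fin n → Sph d × ℝ, ∃ g : C(Sph d, ℝ), IsOutput d α c₁ c₂ ε D g) ∧
        ∃ E : Set (Fin n → Sph d × ℝ), MeasurableSet E ∧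
          ENNReal.ofReal (1 - δ) ≤ sampleLaw d n E ∧
          ∀ ω ∈ E, ∀ g : C(Sph d, ℝ), IsOutput d α c₁ c₂ ε (dataset f ω) g →
            eLpNorm (fun x => f x - g x) ∞ (unif d) ≤ ENNReal.ofReal ε ∧
            (Continuous f → ∀ x, |f x - g x| ≤ ε) := by

  refine ⟨sampleComplexityPoly, ?_⟩
  intro d α c₁ c₂ hα hα1 hc₁ hc₂ hd f hf hdecay hspiky ε δ hε hδ n hn
  obtain ⟨m, rfl⟩ : ∃ m, d = m + 2 := by
    refine ⟨d - 2, ?_⟩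
    have h1 : 0 ≤ 10 * α⁻¹ * (2 : ℝ) ^ (5 / α) := by positivity
    have h2 : (2 : ℝ) ≤ d := by linarith
    have : 2 ≤ d := by exact_mod_cast h2
    omega
  have hm : 10 * α⁻¹ * (2 : ℝ) ^ (5 / α) ≤ m := by
    push_cast at hd
    linarith
  refine ⟨fun D => ?_, ?_⟩
  · obtain ⟨k, hk⟩ := exists_isTruncThreshold hα hα1 hm hc₁ hc₂ hε
    obtain ⟨g, hg, hmin⟩ := exists_isMinOn_funClass hc₁.le k D
    exact ⟨g, k, hk, hg, hmin⟩
  · rcases le_or_gt δ 1 with hδ1 | hδ1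
    · rw [aeval_sampleComplexityPoly] at hn
      exact exists_accuracy_event hα hα1 hc₁ hc₂ hm hf hdecay hspiky hε hδ hδ1 hn
    -- For `δ > 1` the required probability is nonpositive, so the empty event suffices.
    · refine ⟨∅, MeasurableSet.empty, ?_, fun ω hω => hω.elim⟩
      rw [ENNReal.ofReal_of_nonpos (by linarith)]
      exact zero_le
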